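/- **Maslov index of a path.** Let $\Gamma=(\Gamma_t)_{t\in[0,1]}$ be a continuous path in $\mathrm{Sp}(2n)$, acting on $\mathbb{C}^n\simeq\mathbb{R}^{2n}$ with $\Omega=\sum_j dq_j\wedge dp_j$, $z_j=q_j+ip_j$. A quadratic form $Q:\mathbb{C}^n\times\mathbb{C}^k\to\mathbb{R}$ is a *quadratic generating function* of $A\in\mathrm{Sp}(2n)$ if $0$ is a regular value of the fibre derivative $\partial_\xi Q$ and $$\{(q,\partial_qQ(q;\xi)) : \partial_\xi Q(q;\xi)=0\}=\Big\{\Big(\tfrac{z+Az}{2},\, i(z-Az)\Big) : z\in\mathbb{C}^n\Big\},$$ covectors being identified with vectors by the Euclidean inner product. The *Maslov index* of $\Gamma$ is $\operatorname{mas}(\Gamma):=\operatorname{ind}(Q_1)-\operatorname{ind}(Q_0)\in\mathbb{Z}$, where $(Q_t)_{t\in[0,1]}$ is any continuous family of quadratic forms on some $\mathbb{C}^n\times\mathbb{C}^k$ such that $Q_t$ is a quadratic generating function of $\Gamma_t$ for all $t$, and $\operatorname{ind}$ is the maximal dimension of a negative definite subspace. It is *well defined* if such a family exists and the integer does not depend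 on its choice. **Maslov index of a capped fixed point.** Let $(\varphi_t)_{t\in[0,1]}$ be a Hamiltonian flow of a symplectic manifold $(M^{2d},\omega)$ with $\varphi_0=\mathrm{id}$, let $z$ be a fixed point of $\varphi_1$, and let $u:D^2\to M$ be a capping of $z$, that is, a continuous map on the closed unit disk with $u(e^{2i\pi t})=\varphi_t(z)$ for $t\in[0,1]$. For a continuous symplectic trivialization $\xi(w):\mathbb{C}^d\to T_{u(w)}M$, $w\in D^2$, of $u^*TM$, put $\gamma_t:=\xi(e^{2i\pi t})^{-1}\,d\varphi_t(z)\,\xi(1)\in\mathrm{Sp}(2d)$ and $\operatorname{mas}(z,u):=\operatorname{mas}((\gamma_t))$. It is *well defined* if such trivializations exist, and the $\operatorname{mas}((\gamma_t))$ are well defined and the same for all of them. **Proposition.** Let $d\ge 0$, let $\pi:\mathbb{C}^{d+1}\setminus 0\to\mathbb{CP}^d$ be the quotient map, and let $\mathbb{CP}^d$ carry the symplectic form $\omega$ such that $\pi^*\omega$ and $\Omega$ have the same restriction to $S^{2d+1}$. Let $(\Phi_t)_{t\in[0,1]}$ be a $\mathbb{C}$-equivariant Hamiltonian flow on $\mathbb{C}^{d+1}$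 with $\Phi_0=\mathrm{id}$, that is, a family of homeomorphisms of $\mathbb{C}^{d+1}$ with $\Phi_t(\lambda z)=\lambda\Phi_t(z)$ for all $\lambda\in\mathbb{C}$, which restricts to a smooth Hamiltonian flow of $\mathbb{C}^{d+1}\setminus 0$. Assume that it lifts a smooth Hamiltonian flow $(\varphi_t)_{t\in[0,1]}$ on $\mathbb{CP}^d$ with $\varphi_0=\mathrm{id}$, that is, $\pi\circ\Phi_t=\varphi_t\circ\pi$ on $S^{2d+1}$ for $t\in[0,1]$. Let $Z_0\in S^{2d+1}$ be a fixed point of $\Phi_1$, let $U:D^2\to S^{2d+1}$ be any continuous (for instance smooth) map with $U(e^{2i\pi t})=\Phi_t(Z_0)$ for $t\in[0,1]$, and put $z_0:=\pi(Z_0)$, $u:=\pi\circ U$. Then $\operatorname{mas}(Z_0,(\Phi_t)):=\operatorname{mas}\big((d\Phi_t(Z_0))_{t\in[0,1]}\big)$ and $\operatorname{mas}(z_0,u)$ are well defined, and $$\operatorname{mas}(Z_0,(\Phi_t))=\operatorname{mas}(z_0,u).$$ -/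

import Mathlib

open Set
open scoped Manifold ContDiff

noncomputable section

namespace MaslovLift

/-! ## The symplectic vector space `ℂⁿ` -/

/-- `ℂⁿ` with its Hermitian inner product. -/
abbrev Cn (n : ℕ) : Type := EuclideanSpace ℂ (Fin n)

/-- The standard symplectic form `∑ dqⱼ ∧ dpⱼ` of `ℂⁿ`, `zⱼ = qⱼ + i pⱼ`. -/
def stdForm {n : ℕ} (v w : Cn n) : ℝ := (inner ℂ v w).im

/-- A real linear map of `ℂⁿ` belongs to `Sp(2n)`. -/
def IsSymplecticMap {n : ℕ} (A : Cn n →L[ℝ] Cn n) : Prop :=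
  ∀ v w, stdForm (A v) (A w) = stdForm v w

/-! ## Quadratic generating functions and the Maslov index of a symplectic path

For a quadratic form `Q`, the polar form `QuadraticMap.polar Q x y` is the derivative of `Q` at `x`
in the direction `y`. -/

/-- The locus `Σ_Q` of points of `ℂⁿ × ℂᵏ` at which the derivative of `Q` along the fibre `ℂᵏ`
vanishes. -/
def fibreCriticalSet {n k : ℕ} (Q : QuadraticForm ℝ (Cn n × Cn k)) : Set (Cn n × Cn k) :=
  {x | ∀ η : Cn k, QuadraticMap.polar Q x (0, η) = 0}

/-- The subset `{(q, ∂_q Q(q, ξ)) | (q, ξ) ∈ Σ_Q}` of `T^*ℂⁿ = ℂⁿ × ℂⁿ`; covectors are identified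
with vectors through the Euclidean inner product `Re ⟪·, ·⟫`. -/
def generatedSet {n k : ℕ} (Q : QuadraticForm ℝ (Cn n × Cn k)) : Set (Cn n × Cn n) :=
  {y | ∃ x ∈ fibreCriticalSet Q, x.1 = y.1 ∧
    ∀ v : Cn n, QuadraticMap.polar Q x (v, 0) = (inner ℂ y.2 v).re}

/-- The image of the graph of `A` under `τ (z, Z) = ((z + Z) / 2, i (z - Z))`. -/
def graphLagrangian {n : ℕ} (A : Cn n →L[ℝ] Cn n) : Set (Cn n × Cn n) :=
  range fun z => ((2⁻¹ : ℝ) • (z + A z), Complex.I • (z - A z))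

/-- `Q : ℂⁿ × ℂᵏ → ℝ` is a quadratic generating function of the linear map `A`:
`0` is a regular value of the fibre derivative of `Q` (which is linear, so that this means that the
fibre derivative is onto the dual of `ℂᵏ`), and `Q` generates the Lagrangian subspace
associated with the graph of `A`. -/
structure IsQuadraticGenerating {n k : ℕ} (Q : QuadraticForm ℝ (Cn n × Cn k))
    (A : Cn n →L[ℝ] Cn n) : Prop where
  regular : ∀ l : Cn k →ₗ[ℝ] ℝ, ∃ x : Cn n × Cn k,
    ∀ η : Cn k, QuadraticMap.polar Q x (0, η) = l η
  generates : generatedSet Q = graphLagrangian A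

/-- `(Q_t)`, `t ∈ [0, 1]`, is a continuous family of quadratic generating functions of the path
`(Γ_t)`. -/
structure IsGeneratingFamily {n k : ℕ} (Q : ℝ → QuadraticForm ℝ (Cn n × Cn k))
    (Γ : ℝ → (Cn n →L[ℝ] Cn n)) : Prop where
  continuousOn : ∀ x, ContinuousOn (fun t => Q t x) (Icc 0 1)
  generating : ∀ t ∈ Icc (0 : ℝ) 1, IsQuadraticGenerating (Q t) (Γ t)

/-- `(Γ_t)`, `t ∈ [0, 1]`, is a continuous path in `Sp(2n)` whose Maslov index is well defined and
equal to `m`: there is a continuous family of quadratic generating functions of `(Γ_t)`, and every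
such family has index variation `ind Q₁ - ind Q₀ = m`. The index `sigNeg` of a quadratic form
is the maximal dimension of a subspace on which it is negative definite. -/
structure HasMaslovIndex {n : ℕ} (Γ : ℝ → (Cn n →L[ℝ] Cn n)) (m : ℤ) : Prop where
  continuousOn : ContinuousOn Γ (Icc 0 1)
  symplectic : ∀ t ∈ Icc (0 : ℝ) 1, IsSymplecticMap (Γ t)
  exists_family : ∃ (k : ℕ) (Q : ℝ → QuadraticForm ℝ (Cn n × Cn k)), IsGeneratingFamily Q Γ
  index_eq : ∀ (k : ℕ) (Q : ℝ → QuadraticForm ℝ (Cn n × Cn k)), IsGeneratingFamily Q Γ →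
    (sigNeg (Q 1) : ℤ) - (sigNeg (Q 0) : ℤ) = m

/-! ## `ℂ`-equivariant Hamiltonian flows of `ℂⁿ` -/

/-- `(Φ_t)`, `t ∈ [0, 1]`, is a `ℂ`-equivariant Hamiltonian flow of `ℂⁿ`: the `Φ_t` are
`ℂ`-equivariant homeomorphisms of `ℂⁿ` which restrict to a smooth Hamiltonian flow of `ℂⁿ ∖ 0`
starting at the identity. -/
structure IsEquivariantHamiltonianFlow {n : ℕ} (Φ : ℝ → (Cn n ≃ₜ Cn n)) : Prop where
  map_zero : ∀ z, Φ 0 z = z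
  equivariant : ∀ t ∈ Icc (0 : ℝ) 1, ∀ (c : ℂ) (z : Cn n), Φ t (c • z) = c • Φ t z
  smooth : ContDiffOn ℝ ∞ (fun p : ℝ × Cn n => Φ p.1 p.2) (Icc 0 1 ×ˢ {0}ᶜ)
  hamiltonian : ∃ H : ℝ → Cn n → ℝ,
    ContDiffOn ℝ ∞ (fun p : ℝ × Cn n => H p.1 p.2) (Icc 0 1 ×ˢ {0}ᶜ) ∧
    ∀ t ∈ Icc (0 : ℝ) 1, ∀ z : Cn n, z ≠ 0 →
      ∃ X : Cn n, HasDerivWithinAt (fun s => Φ s z) X (Icc 0 1) t ∧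
        ∀ v, stdForm X v = fderiv ℝ (H t) (Φ t z) v

/-! ## Hamiltonian flows and capped fixed points on a manifold with a two-form -/

section Manifold

variable {d : ℕ} {M : Type*} [TopologicalSpace M] [ChartedSpace (Cn d) M]

/-- `(φ_t)`, `t ∈ [0, 1]`, is a smooth Hamiltonian flow of `(M, Ω)` starting at the identity. -/
structure IsHamiltonianFlow
    (Ω : ∀ x : M, TangentSpace 𝓘(ℝ, Cn d) x → TangentSpace 𝓘(ℝ, Cn d) x → ℝ)
    (φ : ℝ → (M ≃ₜ M)) : Prop where
  map_zero : ∀ x, φ 0 x = x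
  smooth : ContMDiffOn (𝓘(ℝ, ℝ).prod 𝓘(ℝ, Cn d)) 𝓘(ℝ, Cn d) ∞
    (fun p : ℝ × M => φ p.1 p.2) (Icc 0 1 ×ˢ univ)
  hamiltonian : ∃ h : ℝ → M → ℝ,
    ContMDiffOn (𝓘(ℝ, ℝ).prod 𝓘(ℝ, Cn d)) 𝓘(ℝ, ℝ) ∞
      (fun p : ℝ × M => h p.1 p.2) (Icc 0 1 ×ˢ univ) ∧
    ∀ t ∈ Icc (0 : ℝ) 1, ∀ x : M,
      ∃ X : TangentSpace 𝓘(ℝ, Cn d) (φ t x),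
        HasMFDerivWithinAt 𝓘(ℝ, ℝ) 𝓘(ℝ, Cn d) (fun s => φ s x) (Icc 0 1) t
          (ContinuousLinearMap.toSpanSingleton ℝ X) ∧
        ∀ v : TangentSpace 𝓘(ℝ, Cn d) (φ t x),
          Ω (φ t x) X v = mfderiv 𝓘(ℝ, Cn d) 𝓘(ℝ, ℝ) (h t) (φ t x) v

/-- The point `e^{2iπt}` of the unit circle. -/
def circlePoint (t : ℝ) : ℂ := Complex.exp (2 * Real.pi * t * Complex.I)

/-- The restriction of `u` to the closed unit disk `D²` is a capping of the loop `(x_t)`, that is,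
`u` is continuous on `D²` and `u(e^{2iπt}) = x_t`. The values of `u` off the disk play no role. -/
structure IsCapping {X : Type*} [TopologicalSpace X] (x : ℝ → X) (u : ℂ → X) : Prop where
  continuousOn : ContinuousOn u (Metric.closedBall 0 1)
  boundary : ∀ t ∈ Icc (0 : ℝ) 1, u (circlePoint t) = x t

variable [IsManifold 𝓘(ℝ, Cn d) 1 M]

/-- `(w, ζ) ↦ ξ(w)ζ`, `w ∈ D²`, is a symplectic trivialization `D² × ℂᵈ → u^*TM`. -/
structure IsSymplecticTrivialization
    (Ω : ∀ x : M, TangentSpace 𝓘(ℝ, Cn d) x → TangentSpace 𝓘(ℝ, Cn d) x → ℝ)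
    (u : ℂ → M) (ξ : ∀ w : ℂ, Cn d ≃L[ℝ] TangentSpace 𝓘(ℝ, Cn d) (u w)) : Prop where
  continuousOn : ContinuousOn
    (fun p : ℂ × Cn d => (⟨u p.1, ξ p.1 p.2⟩ : TangentBundle 𝓘(ℝ, Cn d) M))
    (Metric.closedBall 0 1 ×ˢ univ)
  symplectic : ∀ w ∈ Metric.closedBall (0 : ℂ) 1, ∀ a b : Cn d,
    Ω (u w) (ξ w a) (ξ w b) = stdForm a b

/-- The path `γ_t = ξ(e^{2iπt})⁻¹ ∘ dφ_t(z) ∘ ξ(1)`. It is only used when `u(e^{2iπt}) = φ_t(z)`, and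
then `dφ_t(z)` maps `T_{u(1)}M` to `T_{u(e^{2iπt})}M`. -/
def trivializedPath (φ : ℝ → (M ≃ₜ M)) (z : M) (u : ℂ → M)
    (ξ : ∀ w : ℂ, Cn d ≃L[ℝ] TangentSpace 𝓘(ℝ, Cn d) (u w)) (t : ℝ) : Cn d →L[ℝ] Cn d :=
  let ξ₁ : Cn d →L[ℝ] TangentSpace 𝓘(ℝ, Cn d) (u 1) := ↑(ξ 1)
  let ξt : TangentSpace 𝓘(ℝ, Cn d) (u (circlePoint t)) →L[ℝ] Cn d := ↑(ξ (circlePoint t)).symm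
  ContinuousLinearMap.comp (M₂ := TangentSpace 𝓘(ℝ, Cn d) (φ t z)) ξt
    (ContinuousLinearMap.comp (M₂ := TangentSpace 𝓘(ℝ, Cn d) z)
      (mfderiv 𝓘(ℝ, Cn d) 𝓘(ℝ, Cn d) (φ t) z) ξ₁)

/-- `u` is a capping of the loop `(φ_t(z))` and the Maslov index of `z` with respect to `u` is well
defined and equal to `m`: symplectic trivializations of `u^*TM` exist, and for each of them the path
`(γ_t)` has Maslov index `m`. -/
structure HasCappedMaslovIndex
    (Ω : ∀ x : M, TangentSpace 𝓘(ℝ, Cn d) x → TangentSpace 𝓘(ℝ, Cn d) x → ℝ)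
    (φ : ℝ → (M ≃ₜ M)) (z : M) (u : ℂ → M) (m : ℤ) : Prop where
  isCapping : IsCapping (fun t => φ t z) u
  exists_trivialization : ∃ ξ, IsSymplecticTrivialization Ω u ξ
  index_eq : ∀ ξ, IsSymplecticTrivialization Ω u ξ → HasMaslovIndex (trivializedPath φ z u ξ) m

end Manifold

/-! ## The complex projective space -/

/-- `ℂPᵈ`, the set of complex lines of `ℂᵈ⁺¹`. -/
abbrev CP (d : ℕ) : Type := Projectivization ℂ (Cn (d + 1))

variable {d : ℕ}

/-- The quotient topology. -/
instance : TopologicalSpace (CP d) :=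
  inferInstanceAs (TopologicalSpace (Quotient (projectivizationSetoid ℂ (Cn (d + 1)))))

/-- The real linear embedding `ℂᵈ → ℂᵈ⁺¹` onto the hyperplane `Zᵢ = 0`. -/
def hyperplaneIncl (i : Fin (d + 1)) (w : Cn d) : Cn (d + 1) :=
  WithLp.toLp 2 (i.insertNth (0 : ℂ) (fun j => w j))

/-- The affine embedding `ℂᵈ → ℂᵈ⁺¹` onto the affine hyperplane `Zᵢ = 1`. -/
def affineIncl (i : Fin (d + 1)) (w : Cn d) : Cn (d + 1) :=
  WithLp.toLp 2 (i.insertNth (1 : ℂ) (fun j => w j))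

/-- The vector `(Zⱼ / Zᵢ)`, `j ≠ i`. -/
def affineCoord (i : Fin (d + 1)) (Z : Cn (d + 1)) : Cn d :=
  WithLp.toLp 2 (fun j => Z (i.succAbove j) / Z i)

@[simp] lemma affineIncl_self (i : Fin (d + 1)) (w : Cn d) : affineIncl i w i = 1 := by
  simp [affineIncl]

@[simp] lemma affineIncl_succAbove (i : Fin (d + 1)) (w : Cn d) (j : Fin d) :
    affineIncl i w (i.succAbove j) = w j := by
  simp [affineIncl]

@[simp] lemma hyperplaneIncl_self (i : Fin (d + 1)) (w : Cn d) : hyperplaneIncl i w i = 0 := by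
  simp [hyperplaneIncl]

@[simp] lemma hyperplaneIncl_succAbove (i : Fin (d + 1)) (w : Cn d) (j : Fin d) :
    hyperplaneIncl i w (i.succAbove j) = w j := by
  simp [hyperplaneIncl]

lemma affineIncl_ne_zero (i : Fin (d + 1)) (w : Cn d) : affineIncl i w ≠ 0 := by
  intro h
  have := congrArg (fun Z : Cn (d + 1) => Z i) h
  simp at this

lemma affineCoord_smul (i : Fin (d + 1)) {c : ℂ} (hc : c ≠ 0) (Z : Cn (d + 1)) :
    affineCoord i (c • Z) = affineCoord i Z := by
  ext j
  simp [affineCoord, mul_div_mul_left _ _ hc]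

lemma affineCoord_affineIncl (i : Fin (d + 1)) (w : Cn d) :
    affineCoord i (affineIncl i w) = w := by
  ext j
  simp [affineCoord]

lemma smul_affineIncl_affineCoord (i : Fin (d + 1)) {Z : Cn (d + 1)} (hZ : Z i ≠ 0) :
    Z i • affineIncl i (affineCoord i Z) = Z := by
  ext j
  rcases Fin.eq_self_or_eq_succAbove i j with rfl | ⟨j, rfl⟩
  · simp
  · simp [affineCoord, mul_div_cancel₀ _ hZ]

/-- The quotient map `π : ℂᵈ⁺¹ ∖ 0 → ℂPᵈ`, with an irrelevant value at `0`. -/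
def toCP (Z : Cn (d + 1)) : CP d :=
  if h : Z = 0 then Projectivization.mk ℂ (affineIncl 0 0) (affineIncl_ne_zero 0 0)
  else Projectivization.mk ℂ Z h

lemma toCP_of_ne {Z : Cn (d + 1)} (h : Z ≠ 0) : toCP Z = Projectivization.mk ℂ Z h := dif_neg h

lemma toCP_rep (p : CP d) : toCP p.rep = p := by
  rw [toCP_of_ne p.rep_nonzero, Projectivization.mk_rep]

lemma exists_rep_toCP {Z : Cn (d + 1)} (h : Z ≠ 0) : ∃ c : ℂ, c ≠ 0 ∧ (toCP Z).rep = c • Z := by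
  obtain ⟨a, ha⟩ := Projectivization.exists_smul_eq_mk_rep ℂ Z h
  exact ⟨a, a.ne_zero, by rw [toCP_of_ne h, ← ha]; rfl⟩

lemma toCP_smul {Z : Cn (d + 1)} (h : Z ≠ 0) {c : ℂ} (hc : c ≠ 0) : toCP (c • Z) = toCP Z := by
  rw [toCP_of_ne h, toCP_of_ne (smul_ne_zero hc h), Projectivization.mk_eq_mk_iff']
  exact ⟨c, rfl⟩

/-- The quotient map on nonzero vectors. -/
def quotCP (Z : {Z : Cn (d + 1) // Z ≠ 0}) : CP d := Projectivization.mk ℂ Z.1 Z.2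

lemma isQuotientMap_quotCP : Topology.IsQuotientMap (quotCP (d := d)) := isQuotientMap_quot_mk

lemma quotCP_eq (Z : {Z : Cn (d + 1) // Z ≠ 0}) : quotCP Z = toCP Z.1 := (toCP_of_ne Z.2).symm

lemma continuousAt_toCP {Z : Cn (d + 1)} (hZ : Z ≠ 0) : ContinuousAt toCP Z := by
  have h : ContinuousOn (toCP (d := d)) {Z | Z ≠ 0} := by
    rw [continuousOn_iff_continuous_domRestrict]
    exact isQuotientMap_quotCP.continuous.congr quotCP_eq
  exact h.continuousAt (isOpen_ne.mem_nhds hZ)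

/-- The domain `{Zᵢ ≠ 0}` of the affine chart. -/
def affineDomain (i : Fin (d + 1)) : Set (CP d) := {p | p.rep i ≠ 0}

lemma toCP_mem_affineDomain {i : Fin (d + 1)} {Z : Cn (d + 1)} (hZ : Z ≠ 0) :
    toCP Z ∈ affineDomain i ↔ Z i ≠ 0 := by
  obtain ⟨c, hc, h⟩ := exists_rep_toCP hZ
  simp [affineDomain, h, hc]

lemma affineCoord_rep_toCP (i : Fin (d + 1)) {Z : Cn (d + 1)} (hZ : Z ≠ 0) :
    affineCoord i (toCP Z).rep = affineCoord i Z := by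
  obtain ⟨c, hc, h⟩ := exists_rep_toCP hZ
  rw [h, affineCoord_smul i hc]

lemma contDiff_affineIncl (i : Fin (d + 1)) {n : ℕ∞ω} : ContDiff ℝ n (affineIncl i) := by
  rw [contDiff_piLp]
  intro j
  rcases Fin.eq_self_or_eq_succAbove i j with rfl | ⟨j, rfl⟩
  · simp only [affineIncl_self]; fun_prop
  · simp only [affineIncl_succAbove]; fun_prop

lemma contDiffAt_affineCoord (i : Fin (d + 1)) {n : ℕ∞ω} {Z : Cn (d + 1)} (hZ : Z i ≠ 0) :
    ContDiffAt ℝ n (affineCoord i) Z := by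
  rw [contDiffAt_piLp]
  intro j
  have h (k : Fin (d + 1)) : ContDiffAt ℝ n (fun Y : Cn (d + 1) => Y k) Z := by fun_prop
  simp only [affineCoord, div_eq_mul_inv]
  exact (h (i.succAbove j)).mul ((h i).inv hZ)

lemma isOpen_affineDomain (i : Fin (d + 1)) : IsOpen (affineDomain i) := by
  rw [← isQuotientMap_quotCP.isOpen_preimage]
  have : quotCP ⁻¹' (affineDomain i) = {Z : {Z : Cn (d + 1) // Z ≠ 0} | Z.1 i ≠ 0} := by
    ext Z
    rw [mem_preimage, quotCP_eq, toCP_mem_affineDomain Z.2]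
    rfl
  rw [this]
  exact isOpen_ne_fun (by fun_prop) continuous_const

/-- The affine chart `[Z] ↦ (Zⱼ / Zᵢ)` of `ℂPᵈ`. -/
def affineChart (i : Fin (d + 1)) : OpenPartialHomeomorph (CP d) (Cn d) where
  toFun p := affineCoord i p.rep
  invFun w := toCP (affineIncl i w)
  source := affineDomain i
  target := univ
  map_source' _ _ := mem_univ _
  map_target' w _ := by
    rw [toCP_mem_affineDomain (affineIncl_ne_zero i w)]
    simp
  left_inv' p hp := by
    conv_rhs => rw [← toCP_rep p, ← smul_affineIncl_affineCoord i hp]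
    exact (toCP_smul (affineIncl_ne_zero i _) hp).symm
  right_inv' w _ := by
    rw [affineCoord_rep_toCP i (affineIncl_ne_zero i w), affineCoord_affineIncl]
  open_source := isOpen_affineDomain i
  open_target := isOpen_univ
  continuousOn_toFun := by
    rw [isQuotientMap_quotCP.continuousOn_isOpen_iff (isOpen_affineDomain i)]
    intro Z hZ
    rw [mem_preimage, quotCP_eq, toCP_mem_affineDomain Z.2] at hZ
    have h : (fun p : CP d => affineCoord i p.rep) ∘ quotCP =
        fun Z : {Z : Cn (d + 1) // Z ≠ 0} => affineCoord i Z.1 := by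
      funext Z
      rw [Function.comp_apply, quotCP_eq, affineCoord_rep_toCP i Z.2]
    rw [h]
    exact ((contDiffAt_affineCoord (n := 0) i hZ).continuousAt.comp
      continuousAt_subtype_val).continuousWithinAt
  continuousOn_invFun := fun w _ =>
    ((continuousAt_toCP (affineIncl_ne_zero i w)).comp
      (contDiff_affineIncl (n := 0) i).continuous.continuousAt).continuousWithinAt

lemma exists_mem_affineDomain (p : CP d) : ∃ i, p ∈ affineDomain i := by
  by_contra! h
  apply p.rep_nonzero
  ext i
  simpa [affineDomain] using h i

/-- The index of the preferred affine chart at `p`. -/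
def chartIndex (p : CP d) : Fin (d + 1) := (exists_mem_affineDomain p).choose

lemma mem_affineDomain_chartIndex (p : CP d) : p ∈ affineDomain (chartIndex p) :=
  (exists_mem_affineDomain p).choose_spec

/-- `ℂPᵈ` with its affine charts. -/
instance : ChartedSpace (Cn d) (CP d) where
  atlas := range affineChart
  chartAt p := affineChart (chartIndex p)
  mem_chart_source := mem_affineDomain_chartIndex
  chart_mem_atlas _ := mem_range_self _

instance (n : ℕ∞ω) : IsManifold 𝓘(ℝ, Cn d) n (CP d) := by
  refine isManifold_of_contDiffOn _ _ _ ?_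
  rintro _ _ ⟨i, rfl⟩ ⟨j, rfl⟩ w hw
  have hw' : toCP (affineIncl i w) ∈ affineDomain j := by
    simpa [affineChart] using hw
  rw [toCP_mem_affineDomain (affineIncl_ne_zero i w)] at hw'
  have h : ContDiffAt ℝ n (fun w => affineCoord j (affineIncl i w)) w :=
    (contDiffAt_affineCoord j hw').comp w (contDiff_affineIncl i).contDiffAt
  refine (h.congr_of_eventuallyEq (.of_forall fun w => ?_)).contDiffWithinAt
  exact affineCoord_rep_toCP j (affineIncl_ne_zero i w)

/-- For `Z ≠ 0`, the value on `v, w` of the two-form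
`∑ⱼ dqⱼ ∧ dpⱼ / |Z|² - Im (⟪·, Z⟫ ⟪Z, ·⟫) / |Z|⁴` at `Z`. -/
def homogeneousForm (Z v w : Cn (d + 1)) : ℝ :=
  (inner ℂ v w / (‖Z‖ : ℂ) ^ 2 - inner ℂ v Z * inner ℂ Z w / (‖Z‖ : ℂ) ^ 4).im

/-- The symplectic form of `ℂPᵈ`. If `i` is the index of the preferred chart at `p`,
a tangent vector `a` of `ℂPᵈ` at `p`, written in this chart, is the image under `dπ` of the vector
`hyperplaneIncl i a` at the representative of `p` with `i`-th coordinate `1`. By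
`fubiniStudy_mfderiv_toCP`, this is the form `ω` with `π^*ω = ι^*(∑ⱼ dqⱼ ∧ dpⱼ)`, where
`ι : S²ᵈ⁺¹ → ℂᵈ⁺¹` is the inclusion and `π : S²ᵈ⁺¹ → ℂPᵈ` is the quotient map. -/
def fubiniStudy (p : CP d) (a b : TangentSpace 𝓘(ℝ, Cn d) p) : ℝ :=
  homogeneousForm (affineIncl (chartIndex p) (affineChart (chartIndex p) p))
    (hyperplaneIncl (chartIndex p) a) (hyperplaneIncl (chartIndex p) b)

lemma homogeneousForm_smul {c : ℂ} (hc : c ≠ 0) (Z v w : Cn (d + 1)) :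
    homogeneousForm (c • Z) (c • v) (c • w) = homogeneousForm Z v w := by
  have hc' : (‖c‖ : ℂ) ≠ 0 := by simpa using hc
  have h : (starRingEnd ℂ) c * c = (‖c‖ : ℂ) ^ 2 := by
    rw [mul_comm, Complex.mul_conj, Complex.normSq_eq_norm_sq]; push_cast; rfl
  unfold homogeneousForm
  simp only [inner_smul_left, inner_smul_right, norm_smul, Complex.ofReal_mul]
  congr 1
  have h1 : (c * ((starRingEnd ℂ) c * inner ℂ v w)) / ((‖c‖ : ℂ) * ‖Z‖) ^ 2 =
      inner ℂ v w / (‖Z‖ : ℂ) ^ 2 := by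
    rw [← mul_assoc, mul_comm c, h, mul_pow, mul_div_mul_left _ _ (pow_ne_zero 2 hc')]
  have h2 : (c * ((starRingEnd ℂ) c * inner ℂ v Z)) * (c * ((starRingEnd ℂ) c * inner ℂ Z w)) /
      ((‖c‖ : ℂ) * ‖Z‖) ^ 4 = inner ℂ v Z * inner ℂ Z w / (‖Z‖ : ℂ) ^ 4 := by
    rw [← mul_div_mul_left (inner ℂ v Z * inner ℂ Z w) _ (pow_ne_zero 4 hc'), ← mul_pow]
    congr 1
    linear_combination (inner ℂ v Z * inner ℂ Z w) *
      ((starRingEnd ℂ) c * c + (‖c‖ : ℂ) ^ 2) * h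
  rw [← h1, ← h2]

lemma homogeneousForm_add_smul {Z : Cn (d + 1)} (hZ : Z ≠ 0) (v w : Cn (d + 1)) (a b : ℂ) :
    homogeneousForm Z (v + a • Z) (w + b • Z) = homogeneousForm Z v w := by
  have hZ' : (‖Z‖ : ℂ) ≠ 0 := by simpa using hZ
  have h : inner ℂ Z Z = (‖Z‖ : ℂ) ^ 2 := inner_self_eq_norm_sq_to_K Z
  unfold homogeneousForm
  simp only [inner_add_left, inner_add_right, inner_smul_left, inner_smul_right, h]
  congr 1
  field_simp
  ring

lemma hyperplaneIncl_fderiv_affineCoord (i : Fin (d + 1)) {Z : Cn (d + 1)} (hZ : Z i ≠ 0)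
    (v : Cn (d + 1)) :
    hyperplaneIncl i (fderiv ℝ (affineCoord i) Z v) =
      (Z i)⁻¹ • v + (-(v i) / (Z i) ^ 2) • Z := by
  have hd : DifferentiableAt ℝ (affineCoord i) Z :=
    (contDiffAt_affineCoord (n := 1) i hZ).differentiableAt one_ne_zero
  ext j
  rcases Fin.eq_self_or_eq_succAbove i j with rfl | ⟨j, rfl⟩
  · simp
    field_simp
    ring
  · rw [hyperplaneIncl_succAbove]
    have hl (k : Fin (d + 1)) : HasDerivAt (fun s : ℝ => Z k + s * v k) (v k) 0 := by
      simpa using ((Complex.ofRealCLM.hasDerivAt (x := 0)).mul_const (v k)).const_add (Z k)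
    have hL : HasDerivAt (fun s : ℝ => Z + s • v) v 0 := by
      simpa using ((hasDerivAt_id (0 : ℝ)).smul_const v).const_add Z
    have h1 : HasDerivAt (fun s : ℝ => affineCoord i (Z + s • v) j)
        (fderiv ℝ (affineCoord i) Z v j) 0 := by
      have h := HasFDerivAt.comp_hasDerivAt (0 : ℝ) (l := affineCoord i)
        (by simpa using hd.hasFDerivAt) hL
      exact (((EuclideanSpace.proj (𝕜 := ℂ) j : Cn d →L[ℂ] ℂ).restrictScalars ℝ
        ).hasFDerivAt.comp_hasDerivAt (0 : ℝ) h)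
    have h2 := (hl (i.succAbove j)).fun_div (hl i) (by simpa using hZ)
    have h3 := h1.unique (h2.congr_of_eventuallyEq (.of_forall fun s => by simp [affineCoord]))
    rw [h3]
    simp
    field_simp
    ring

lemma mfderiv_toCP {Z : Cn (d + 1)} (hZ : Z ≠ 0) :
    mfderiv 𝓘(ℝ, Cn (d + 1)) 𝓘(ℝ, Cn d) toCP Z = fderiv ℝ (affineCoord (chartIndex (toCP Z))) Z := by
  have hi : Z (chartIndex (toCP Z)) ≠ 0 :=
    (toCP_mem_affineDomain hZ).1 (mem_affineDomain_chartIndex _)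
  have hd : DifferentiableAt ℝ (affineCoord (chartIndex (toCP Z))) Z :=
    (contDiffAt_affineCoord (n := 1) _ hi).differentiableAt one_ne_zero
  have he : writtenInExtChartAt 𝓘(ℝ, Cn (d + 1)) 𝓘(ℝ, Cn d) Z toCP =ᶠ[nhds Z]
      affineCoord (chartIndex (toCP Z)) := by
    filter_upwards [isOpen_ne.mem_nhds hZ] with Y hY
    exact affineCoord_rep_toCP _ hY
  have hm : MDifferentiableAt 𝓘(ℝ, Cn (d + 1)) 𝓘(ℝ, Cn d) toCP Z := by
    rw [mdifferentiableAt_iff]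
    refine ⟨continuousAt_toCP hZ, ?_⟩
    exact (hd.congr_of_eventuallyEq he).differentiableWithinAt
  rw [hm.mfderiv]
  simp only [modelWithCornersSelf_coe, range_id, fderivWithin_univ]
  exact he.fderiv_eq

/-- `π^*ω = ι^*(∑ⱼ dqⱼ ∧ dpⱼ)` on the unit sphere. -/
lemma fubiniStudy_mfderiv_toCP {Z : Cn (d + 1)} (hZ : ‖Z‖ = 1) {v w : Cn (d + 1)}
    (hv : (inner ℂ Z v).re = 0) (hw : (inner ℂ Z w).re = 0) :
    fubiniStudy (toCP Z) (mfderiv 𝓘(ℝ, Cn (d + 1)) 𝓘(ℝ, Cn d) toCP Z v)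
      (mfderiv 𝓘(ℝ, Cn (d + 1)) 𝓘(ℝ, Cn d) toCP Z w) = stdForm v w := by
  have hZ0 : Z ≠ 0 := by rintro rfl; simp at hZ
  have hi : Z (chartIndex (toCP Z)) ≠ 0 :=
    (toCP_mem_affineDomain hZ0).1 (mem_affineDomain_chartIndex _)
  have hA : affineIncl (chartIndex (toCP Z)) (affineChart (chartIndex (toCP Z)) (toCP Z)) =
      (Z (chartIndex (toCP Z)))⁻¹ • Z := by
    rw [eq_inv_smul_iff₀ hi]
    refine Eq.trans ?_ (smul_affineIncl_affineCoord _ hi)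
    exact congrArg _ (congrArg _ (affineCoord_rep_toCP _ hZ0))
  have hform (x y : Cn (d + 1)) : homogeneousForm ((Z (chartIndex (toCP Z)))⁻¹ • Z)
      (hyperplaneIncl (chartIndex (toCP Z)) (fderiv ℝ (affineCoord (chartIndex (toCP Z))) Z x))
      (hyperplaneIncl (chartIndex (toCP Z)) (fderiv ℝ (affineCoord (chartIndex (toCP Z))) Z y)) =
      homogeneousForm Z x y := by
    have hsplit (x : Cn (d + 1)) :
        hyperplaneIncl (chartIndex (toCP Z)) (fderiv ℝ (affineCoord (chartIndex (toCP Z))) Z x) =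
        (Z (chartIndex (toCP Z)))⁻¹ •
          (x + (-(x (chartIndex (toCP Z))) / Z (chartIndex (toCP Z))) • Z) := by
      rw [hyperplaneIncl_fderiv_affineCoord _ hi, smul_add, smul_smul]
      congr 2
      field_simp
    rw [hsplit, hsplit, homogeneousForm_smul (inv_ne_zero hi), homogeneousForm_add_smul hZ0]
  rw [mfderiv_toCP hZ0]
  unfold fubiniStudy
  rw [hA]
  refine (hform v w).trans ?_
  have h1 : (inner ℂ v Z).re = 0 := by rw [← inner_conj_symm, Complex.conj_re, hv]
  simp [homogeneousForm, stdForm, hZ, Complex.mul_im, h1, hw]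

end MaslovLift

end

open MaslovLift

noncomputable section

namespace MaslovLift

open Filter Topology QuadraticMap

/-! ### Semicontinuity and comparison of inertia indices -/

section Signature

variable {E F : Type*} [NormedAddCommGroup E] [NormedSpace ℝ E] [FiniteDimensional ℝ E]
  [AddCommGroup F] [Module ℝ F] [FiniteDimensional ℝ F]

/-! Well-definedness. Two generating functions of one path are compared through the form `Q - Q'` on
the fibre product over the common base. Its radical is parametrized by the graph of the linear map,
so its dimension never changes, and semicontinuity of the inertia indices keeps its index constant.
This index is `ind Q - ind Q'` up to a constant (`sigNeg_fibreDifference`), so the index variation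
depends on the path alone. For existence, a path starting at the identity is cut into factors close
to the identity; each has a Cayley generating function without fibre variables, and a composition
formula (`isQuadraticGenerating_compForm`) assembles them. Carried out with a compact parameter
(`hasGeneratingFamily_of_homotopy`), the construction also gives invariance under homotopies with
fixed ends.

Comparison. Differentiated equivariance gives `dΦ_t(Z₀)(cZ₀) = cΦ_t(Z₀)`, and Hamilton's equation
makes `dΦ_t(Z₀)` symplectic. Hence it carries the Hermitian complement of `Z₀` to that of `Φ_t(Z₀)`,
where `dπ` is a symplectic isomorphism conjugating it to `dφ_t`. A symplectic trivialization of
`u^*TM` lifts horizontally to frames of the complements of `U(w)`. Adding the vector `U(w)`, which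
frames the tautological line over the whole disk, gives symplectic maps `M(w)` of `ℂᵈ⁺¹` with `M(1)
= 1`, and `M(e^{2iπt})⁻¹ dΦ_t(Z₀)` is the direct sum of `γ_t` and of the identity of `ℂZ₀`. It is
homotopic to `dΦ_t(Z₀)` with fixed ends through `M(s) M(s e^{2iπt})⁻¹ dΦ_t(Z₀)`. Finally, the
identity summand does not count: a generating function of `γ_t`, pulled back by the projection,
generates the direct sum and keeps its index (`HasMaslovIndex.of_stabilization`). -/

lemma continuous_uncurry_quadraticForm {T : Type*} [TopologicalSpace T] {Q : T → QuadraticForm ℝ E}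
    (hQ : ∀ x, Continuous fun t => Q t x) : Continuous fun p : T × E => Q p.1 p.2 := by
  let b := Module.finBasis ℝ E
  have h (p : T × E) : Q p.1 p.2 = 2⁻¹ * ∑ i, ∑ j,
      b.repr p.2 i * (b.repr p.2 j * polar (Q p.1) (b i) (b j)) := by
    have h1 : polar (Q p.1) p.2 p.2 = 2 * Q p.1 p.2 := by
      simp [QuadraticMap.polar_self]
    have h2 : polar (Q p.1) p.2 p.2 = ∑ i, ∑ j,
      b.repr p.2 i * (b.repr p.2 j * polar (Q p.1) (b i) (b j)) := by
      rw [← polarBilin_apply_apply]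
      conv_lhs => rw [← b.sum_repr p.2]
      simp only [map_sum, LinearMap.sum_apply, map_smul, LinearMap.smul_apply, smul_eq_mul,
        polarBilin_apply_apply]
      rw [Finset.sum_comm]
      simp only [Finset.mul_sum]
      rw [Finset.sum_comm]
      exact Finset.sum_congr rfl fun i _ => Finset.sum_congr rfl fun j _ => by rw [polar_comm]
    rw [← h2, h1]; ring
  simp only [h]
  have hc (i) : Continuous fun p : T × E => b.repr p.2 i :=
    (LinearMap.continuous_of_finiteDimensional (b.coord i)).comp continuous_snd
  have hp (i j) : Continuous fun p : T × E => polar (Q p.1) (b i) (b j) := by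
    unfold polar
    exact (((hQ _).comp continuous_fst).sub ((hQ _).comp continuous_fst)).sub
      ((hQ _).comp continuous_fst)
  fun_prop

/-- Positivity on the compact unit sphere of a maximal positive definite subspace of `Q t₀` persists
for nearby parameters. -/
lemma eventually_sigPos_le {T : Type*} [TopologicalSpace T] {Q : T → QuadraticForm ℝ E}
    (hQ : ∀ x, Continuous fun t => Q t x) (t₀ : T) :
    ∀ᶠ t in 𝓝 t₀, sigPos (Q t₀) ≤ sigPos (Q t) := by
  obtain ⟨V, hV, hpos⟩ := exists_finrank_eq_sigPos_and_posDef (Q t₀)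
  have hK : IsCompact ((V : Set E) ∩ Metric.sphere 0 1) :=
    (isCompact_sphere _ _).inter_left V.closed_of_finiteDimensional
  have h := hK.eventually_forall_of_forall_eventually (x₀ := t₀)
    (P := fun t x => 0 < Q t x) (fun x hx => by
      have hx0 : x ≠ 0 := by rintro rfl; simpa using hx.2
      have := hpos ⟨x, hx.1⟩ (by simpa using hx0)
      exact (continuous_uncurry_quadraticForm hQ).continuousAt.eventually_const_lt this)
  filter_upwards [h] with t ht
  rw [← hV]
  refine le_sigPos_of_posDef _ fun x hx => ?_
  have hx0 : ‖(x : E)‖ ≠ 0 := by simpa using hx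
  have h1 := ht (‖(x : E)‖⁻¹ • (x : E)) ⟨V.smul_mem _ x.2, by
    simp [norm_smul, hx0]⟩
  rw [QuadraticMap.map_smul, smul_eq_mul] at h1
  exact pos_of_mul_pos_right h1 (by positivity)

/-- Both inertia indices are lower semicontinuous, and a radical of fixed dimension fixes their sum;
so neither can jump. -/
lemma sigNeg_eq_of_finrank_radical_eq {T : Type*} [TopologicalSpace T] [PreconnectedSpace T]
    {Q : T → QuadraticForm ℝ E} (hQ : ∀ x, Continuous fun t => Q t x) {m : ℕ}
    (hm : ∀ t, Module.finrank ℝ (Q t).radical = m) (s t : T) : sigNeg (Q s) = sigNeg (Q t) := by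
  refine IsLocallyConstant.apply_eq_of_preconnectedSpace (f := fun t => sigNeg (Q t)) ?_ s t
  rw [IsLocallyConstant.iff_eventually_eq]
  intro t₀
  have h2 := eventually_sigPos_le (Q := fun t => -Q t)
    (fun x => (hQ x).neg) t₀
  filter_upwards [eventually_sigPos_le hQ t₀, h2] with t h1 h2
  have h3 := QuadraticForm.sigPos_add_sigNeg_add_radical (Q := Q t)
  have h4 := QuadraticForm.sigPos_add_sigNeg_add_radical (Q := Q t₀)
  rw [hm] at h3 h4
  simp only [sigPos_neg] at h2
  omega

/-- The image under `j` of a negative definite subspace meets the isotropic space `W` only in zero,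
and by orthogonality `S` is nonpositive on their sum. A positive definite subspace meets this sum
trivially, which bounds the dimensions. -/
lemma sigPos_add_sigNeg_comp_add_finrank_le {E : Type*} [AddCommGroup E] [Module ℝ E]
    [FiniteDimensional ℝ E] (S : QuadraticForm ℝ E) (j : F →ₗ[ℝ] E)
    (hj : Function.Injective j) (W : Submodule ℝ E) (hW : ∀ w ∈ W, S w = 0)
    (hWj : ∀ w ∈ W, ∀ x, polar S w (j x) = 0) :
    sigPos S + sigNeg (S.comp j) + Module.finrank ℝ W ≤ Module.finrank ℝ E := by
  obtain ⟨N, hN, hneg⟩ := exists_finrank_eq_sigNeg_and_negDef (S.comp j)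
  have hneg' (x : F) (hx : x ∈ N) (hx0 : x ≠ 0) : S (j x) < 0 := by
    simpa using hneg ⟨x, hx⟩ (by simpa using hx0)
  have hdisj : N.map j ⊓ W = ⊥ := by
    rw [Submodule.eq_bot_iff]
    rintro _ ⟨⟨x, hx, rfl⟩, hw⟩
    by_contra h0
    have := hneg' x hx (by rintro rfl; simp at h0)
    linarith [hW _ hw]
  have hdim := Submodule.finrank_sup_add_finrank_inf_eq (N.map j) W
  rw [hdisj, finrank_bot, add_zero, (Submodule.equivMapOfInjective j hj N).symm.finrank_eq,
    hN] at hdim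
  have := QuadraticForm.sigPos_add_finrank_le_of_nonpos (Q := S) (V := N.map j ⊔ W) (by
    intro y hy
    obtain ⟨_, ⟨x, hx, rfl⟩, w, hw, rfl⟩ := Submodule.mem_sup.1 hy
    rw [add_comm, QuadraticMap.map_add S w (j x), hW w hw, hWj w hw]
    rcases eq_or_ne x 0 with rfl | h0
    · simp
    · simpa using (hneg' x hx h0).le)
  omega

/-- One inequality is enough: the dimension count in `sigNeg_fibreDifference` is tight. -/
lemma sigPos_add_sigPos_le_sigPos_prod {E F : Type*} [AddCommGroup E] [Module ℝ E]
    [FiniteDimensional ℝ E] [AddCommGroup F] [Module ℝ F] [FiniteDimensional ℝ F]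
    (Q : QuadraticForm ℝ E) (Q' : QuadraticForm ℝ F) :
    sigPos Q + sigPos Q' ≤ sigPos (Q.prod Q') := by
  obtain ⟨V, hV, hp⟩ := exists_finrank_eq_sigPos_and_posDef Q
  obtain ⟨V', hV', hp'⟩ := exists_finrank_eq_sigPos_and_posDef Q'
  rw [← hV, ← hV', ← Module.finrank_prod, ← LinearMap.finrank_range_of_inj (f := V.subtype.prodMap V'.subtype)
      (Prod.map_injective.2 ⟨V.subtype_injective, V'.subtype_injective⟩)]
  refine le_sigPos_of_posDef _ ?_
  rintro ⟨_, ⟨⟨⟨x, hx⟩, ⟨y, hy⟩⟩, rfl⟩⟩ h0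
  have h1 : 0 ≤ Q x ∧ (x ≠ 0 → 0 < Q x) := by
    rcases eq_or_ne x 0 with rfl | h
    · simp
    · have : 0 < Q x := hp ⟨x, hx⟩ (by simpa using h)
      exact ⟨this.le, fun _ => this⟩
  have h2 : 0 ≤ Q' y ∧ (y ≠ 0 → 0 < Q' y) := by
    rcases eq_or_ne y 0 with rfl | h
    · simp
    · have : 0 < Q' y := hp' ⟨y, hy⟩ (by simpa using h)
      exact ⟨this.le, fun _ => this⟩
  change 0 < Q x + Q' y
  by_cases hx0 : x = 0
  · have : y ≠ 0 := by rintro rfl; subst hx0; exact h0 rfl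
    linarith [h2.2 this]
  · linarith [h1.2 hx0]

/-- A negative definite subspace upstairs avoids the kernel of `f`, hence maps injectively; a linear
section of `f` carries negative definite subspaces back. -/
lemma sigNeg_comp_of_surjective {E F : Type*} [AddCommGroup E] [Module ℝ E]
    [FiniteDimensional ℝ E] [AddCommGroup F] [Module ℝ F] [FiniteDimensional ℝ F]
    (Q : QuadraticForm ℝ F) (f : E →ₗ[ℝ] F) (hf : Function.Surjective f) :
    sigNeg (Q.comp f) = sigNeg Q := by
  apply le_antisymm
  · obtain ⟨V, hV, hp⟩ := exists_finrank_eq_sigNeg_and_negDef (Q.comp f)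
    have hlt (x) (hx : x ∈ V) (h0 : x ≠ 0) : Q (f x) < 0 := by
      simpa using hp ⟨x, hx⟩ (by simpa using h0)
    have hinj : Function.Injective (f.domRestrict V) := by
      rw [← LinearMap.ker_eq_bot, LinearMap.ker_eq_bot']
      rintro ⟨x, hx⟩ h
      by_contra h0
      have := hlt x hx (by simpa using h0)
      rw [show f x = 0 from h] at this
      simp at this
    rw [← hV, ← LinearMap.finrank_range_of_inj hinj]
    refine le_sigNeg_of_negDef _ ?_
    rintro ⟨_, ⟨x, hx⟩, rfl⟩ h0
    have := hlt x hx (by rintro rfl; exact h0 (by ext; simp))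
    simpa using this
  · obtain ⟨V, hV, hp⟩ := exists_finrank_eq_sigNeg_and_negDef Q
    obtain ⟨g, hg⟩ := f.exists_rightInverse_of_surjective (LinearMap.range_eq_top.2 hf)
    have hg' (y) : f (g y) = y := LinearMap.congr_fun hg y
    have hinj : Function.Injective g := Function.LeftInverse.injective hg'
    rw [← hV, (Submodule.equivMapOfInjective g hinj V).finrank_eq]
    refine le_sigNeg_of_negDef _ ?_
    rintro ⟨_, y, hy, rfl⟩ h0
    have : 0 < (-Q) y := hp ⟨y, hy⟩ (by intro h; apply h0; ext; simp at h; simp [h])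
    simpa [hg'] using this

end Signature

/-! ### Uniqueness: comparing two generating functions of one map -/

section GeneratingForms

variable {n k k' : ℕ}

lemma exists_eq_re_inner (l : Cn n →ₗ[ℝ] ℝ) : ∃ p : Cn n, ∀ v, l v = (inner ℂ p v).re := by
  refine ⟨(InnerProductSpace.toDual ℝ (Cn n)).symm (LinearMap.toContinuousLinearMap l), fun v => ?_⟩
  have h := InnerProductSpace.toDual_symm_apply (𝕜 := ℝ) (x := v)
    (y := LinearMap.toContinuousLinearMap l)
  rw [LinearMap.coe_toContinuousLinearMap'] at h
  rw [← h]
  generalize (InnerProductSpace.toDual ℝ (Cn n)).symm (LinearMap.toContinuousLinearMap l) = p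
  simp [PiLp.inner_apply]

lemma eq_of_re_inner_eq {p p' : Cn n} (h : ∀ v, (inner ℂ p v).re = (inner ℂ p' v).re) :
    p = p' := by
  have h1 := h (p - p')
  rw [← sub_eq_zero, ← Complex.sub_re, ← inner_sub_left] at h1
  exact sub_eq_zero.1 (by simpa [← Complex.ofReal_pow] using h1)

lemma polar_mk_add (Q : QuadraticForm ℝ (Cn n × Cn k)) (x : Cn n × Cn k) (v : Cn n) (η : Cn k) :
    polar Q x (v, η) = polar Q x (v, 0) + polar Q x (0, η) := by
  rw [← QuadraticMap.polar_add_right]; simp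

/-- Regularity realizes the functional `Re ⟪ξ, ·⟫` as a fibre derivative; evaluated at `ξ` it gives
`‖ξ‖² = 0`. -/
lemma IsQuadraticGenerating.eq_zero_of_polar {Q : QuadraticForm ℝ (Cn n × Cn k)}
    {A : Cn n →L[ℝ] Cn n} (h : IsQuadraticGenerating Q A) {ξ : Cn k}
    (hξ : ∀ x, polar Q x (0, ξ) = 0) : ξ = 0 := by
  obtain ⟨x, hx⟩ := h.regular ((Complex.reLm).comp ((innerₛₗ ℂ ξ).restrictScalars ℝ))
  have := hx ξ
  rw [hξ] at this
  simpa [← Complex.ofReal_pow] using this.symm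

/-- Duality: a proper range would be annihilated by a nonzero functional on the dual of `ℂᵏ`, which
is evaluation at some fibre vector. -/
lemma surjective_fibreDerivative {Q : QuadraticForm ℝ (Cn n × Cn k)}
    (h : ∀ ξ : Cn k, (∀ x, polar Q x (0, ξ) = 0) → ξ = 0) (l : Cn k →ₗ[ℝ] ℝ) :
    ∃ x : Cn n × Cn k, ∀ η : Cn k, polar Q x (0, η) = l η := by
  let f : Cn n × Cn k →ₗ[ℝ] Module.Dual ℝ (Cn k) :=
    (LinearMap.lcomp ℝ ℝ (LinearMap.inr ℝ (Cn n) (Cn k))).comp Q.polarBilin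
  have hf (x η) : f x η = polar Q x (0, η) := rfl
  suffices hr : LinearMap.range f = ⊤ by
    obtain ⟨x, hx⟩ := LinearMap.range_eq_top.1 hr l
    exact ⟨x, fun η => by rw [← hf, hx]⟩
  by_contra hr
  obtain ⟨g, hg, hle⟩ := Submodule.exists_le_ker_of_lt_top _ (lt_top_iff_ne_top.2 hr)
  obtain ⟨ξ, rfl⟩ := (Module.evalEquiv ℝ (Cn k)).surjective g
  apply hg
  rw [h ξ fun x => ?_, map_zero]
  exact hle (LinearMap.mem_range_self f x)

/-- The critical points of a generating function of `A` are parametrized linearly by `ℂⁿ`. -/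
lemma IsQuadraticGenerating.exists_section {Q : QuadraticForm ℝ (Cn n × Cn k)}
    {A : Cn n →L[ℝ] Cn n} (h : IsQuadraticGenerating Q A) :
    ∃ σ : Cn n →ₗ[ℝ] Cn n × Cn k, Function.Injective σ ∧
      (∀ z, (σ z).1 = (2⁻¹ : ℝ) • (z + A z)) ∧
      (∀ z v η, polar Q (σ z) (v, η) = (inner ℂ (Complex.I • (z - A z)) v).re) ∧
      ∀ x p, (∀ v η, polar Q x (v, η) = (inner ℂ p v).re) →
        ∃ z, σ z = x ∧ Complex.I • (z - A z) = p := by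
  have hex (z : Cn n) : ∃ x : Cn n × Cn k, x.1 = (2⁻¹ : ℝ) • (z + A z) ∧
      ∀ v η, polar Q x (v, η) = (inner ℂ (Complex.I • (z - A z)) v).re := by
    obtain ⟨x, hx, h1, h2⟩ : ((2⁻¹ : ℝ) • (z + A z), Complex.I • (z - A z)) ∈ generatedSet Q := by
      rw [h.generates]; exact ⟨z, rfl⟩
    exact ⟨x, h1, fun v η => by rw [polar_mk_add, h2, hx η, add_zero]⟩
  -- Two points with the same base component and the same derivative differ by a fibre vector in the
  -- radical, which regularity excludes. This uniqueness makes the choice `s` linear.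
  have huniq {x y : Cn n × Cn k} (h1 : x.1 = y.1) (h2 : ∀ w, polar Q x w = polar Q y w) :
      x = y := by
    have h3 : x - y = (0, x.2 - y.2) := Prod.ext (by simp [h1]) rfl
    have h4 : x.2 - y.2 = 0 := h.eq_zero_of_polar fun w => by
      rw [polar_comm, ← h3, QuadraticMap.polar_sub_left, h2, sub_self]
    rw [← sub_eq_zero, h3, h4]; rfl
  choose s hs1 hs2 using hex
  let σ : Cn n →ₗ[ℝ] Cn n × Cn k :=
    { toFun := s
      map_add' := fun z w => huniq
        (by simp only [Prod.fst_add, hs1, map_add]; module) (fun x => by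
          obtain ⟨v, η⟩ := x
          rw [QuadraticMap.polar_add_left, hs2, hs2, hs2, ← Complex.add_re, ← inner_add_left]
          congr 2; simp only [map_add]; module)
      map_smul' := fun c z => huniq
        (by simp only [Prod.smul_fst, hs1, map_smul, RingHom.id_apply]; module) (fun x => by
          obtain ⟨v, η⟩ := x
          have : Complex.I • (c • z - A (c • z)) = (c : ℂ) • Complex.I • (z - A z) := by
            simp only [map_smul, Complex.coe_smul, ← smul_sub]; rw [smul_comm]
          rw [RingHom.id_apply, QuadraticMap.polar_smul_left, hs2, hs2, this, inner_smul_left,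
            Complex.conj_ofReal, Complex.re_ofReal_mul, smul_eq_mul]) }
  have hσ (z) : σ z = s z := rfl
  refine ⟨σ, ?_, hs1, hs2, fun x p hx => ?_⟩
  · rw [← LinearMap.ker_eq_bot, LinearMap.ker_eq_bot']
    intro z hz
    have h1 : z + A z = 0 := by
      have := hs1 z; rw [← hσ, hz] at this
      simpa [-smul_add] using this.symm
    have h2 : Complex.I • (z - A z) = 0 := eq_of_re_inner_eq fun v => by
      rw [← hs2 z v 0, ← hσ, hz]; simp
    have h3 : z - A z = 0 := by simpa using h2
    have h4 : (2 : ℝ) • z = (z + A z) + (z - A z) := by module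
    rw [h1, h3, add_zero] at h4
    simpa using h4
  · have hm : (x.1, p) ∈ generatedSet Q := by
      refine ⟨x, fun η => ?_, rfl, fun v => hx v 0⟩
      rw [hx]; simp
    rw [h.generates] at hm
    obtain ⟨z, hz⟩ := hm
    have hz1 : (2⁻¹ : ℝ) • (z + A z) = x.1 := congrArg Prod.fst hz
    have hz2 : Complex.I • (z - A z) = p := congrArg Prod.snd hz
    refine ⟨z, huniq ((hs1 z).trans hz1) ?_, hz2⟩
    rintro ⟨v, η⟩
    rw [hσ, hs2, hx, hz2]

lemma stdForm_eq_re_inner (v w : Cn n) : stdForm v w = (inner ℂ (Complex.I • v) w).re := by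
  simp [stdForm]

lemma mem_radical_iff_polar {E : Type*} [AddCommGroup E] [Module ℝ E] {Q : QuadraticForm ℝ E}
    {x : E} : x ∈ Q.radical ↔ ∀ y, polar Q x y = 0 := by
  rw [QuadraticMap.radical_eq_ker_polarBilin, LinearMap.mem_ker, LinearMap.ext_iff]
  rfl

/-- The radical consists of the critical points with zero covector, that is, of the `σ z` with `z =
A z`. -/
lemma IsQuadraticGenerating.finrank_radical {Q : QuadraticForm ℝ (Cn n × Cn k)}
    {A : Cn n →L[ℝ] Cn n} (h : IsQuadraticGenerating Q A) :
    Module.finrank ℝ Q.radical = Module.finrank ℝ (LinearMap.ker (LinearMap.id - (A : Cn n →ₗ[ℝ] Cn n))) := by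
  obtain ⟨σ, hinj, h1, h2, h3⟩ := h.exists_section
  have : Q.radical = (LinearMap.ker (LinearMap.id - (A : Cn n →ₗ[ℝ] Cn n))).map σ := by
    ext x
    rw [mem_radical_iff_polar, Submodule.mem_map]
    constructor
    · intro hx
      obtain ⟨z, hz, hz'⟩ := h3 x 0 (fun v η => by simp [hx])
      exact ⟨z, by simpa using hz', hz⟩
    · rintro ⟨z, hz, rfl⟩ ⟨v, η⟩
      have hz : z - A z = 0 := by simpa using hz
      rw [h2, hz]; simp
  rw [this, (Submodule.equivMapOfInjective σ hinj _).finrank_eq]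

/-- The form `(q, ξ, ξ') ↦ Q(q, ξ) - Q'(q, ξ')`. -/
def fibreDifference (Q : QuadraticForm ℝ (Cn n × Cn k)) (Q' : QuadraticForm ℝ (Cn n × Cn k')) :
    QuadraticForm ℝ (Cn n × (Cn k × Cn k')) :=
  (Q.prod (-Q')).comp
    (((LinearMap.fst ℝ _ _).prod ((LinearMap.fst ℝ _ _).comp (LinearMap.snd ℝ _ _))).prod
      ((LinearMap.fst ℝ _ _).prod ((LinearMap.snd ℝ _ _).comp (LinearMap.snd ℝ _ _))))

lemma fibreDifference_apply (Q : QuadraticForm ℝ (Cn n × Cn k))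
    (Q' : QuadraticForm ℝ (Cn n × Cn k')) (x : Cn n × (Cn k × Cn k')) :
    fibreDifference Q Q' x = Q (x.1, x.2.1) - Q' (x.1, x.2.2) := by
  simp [fibreDifference, sub_eq_add_neg]

lemma polar_fibreDifference (Q : QuadraticForm ℝ (Cn n × Cn k))
    (Q' : QuadraticForm ℝ (Cn n × Cn k')) (x y : Cn n × (Cn k × Cn k')) :
    polar (fibreDifference Q Q') x y =
      polar Q (x.1, x.2.1) (y.1, y.2.1) - polar Q' (x.1, x.2.2) (y.1, y.2.2) := by
  simp only [polar, fibreDifference_apply, Prod.fst_add, Prod.snd_add, Prod.mk_add_mk]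
  ring

/-- A point is in the radical when its two halves are critical for `Q` and `Q'` with the same
covector. Both then represent the same point of the Lagrangian subspace, hence the same `z`, and `z`
parametrizes the radical. -/
lemma finrank_radical_fibreDifference {Q : QuadraticForm ℝ (Cn n × Cn k)}
    {Q' : QuadraticForm ℝ (Cn n × Cn k')} {A : Cn n →L[ℝ] Cn n}
    (h : IsQuadraticGenerating Q A) (h' : IsQuadraticGenerating Q' A) :
    Module.finrank ℝ (fibreDifference Q Q').radical = Module.finrank ℝ (Cn n) := by
  obtain ⟨σ, hinj, h1, h2, h3⟩ := h.exists_section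
  obtain ⟨σ', hinj', h1', h2', h3'⟩ := h'.exists_section
  let τ : Cn n →ₗ[ℝ] Cn n × (Cn k × Cn k') :=
    ((LinearMap.fst ℝ _ _).comp σ).prod
      (((LinearMap.snd ℝ _ _).comp σ).prod ((LinearMap.snd ℝ _ _).comp σ'))
  have hτ (z) : τ z = ((σ z).1, (σ z).2, (σ' z).2) := rfl
  have hτinj : Function.Injective τ := fun z w hzw => hinj (by
    simp only [hτ, Prod.mk.injEq] at hzw
    exact Prod.ext hzw.1 hzw.2.1)
  rw [← LinearMap.finrank_range_of_inj hτinj]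
  suffices hr : (fibreDifference Q Q').radical = LinearMap.range τ by rw [hr]
  ext x
  rw [mem_radical_iff_polar, LinearMap.mem_range]
  constructor
  · obtain ⟨q, ξ, ξ'⟩ := x
    intro hx
    simp only [polar_fibreDifference, Prod.forall] at hx
    obtain ⟨p, hp⟩ := exists_eq_re_inner
      ((Q.polarBilin (q, ξ)).comp (LinearMap.inl ℝ (Cn n) (Cn k)))
    have hp (v) : polar Q (q, ξ) (v, 0) = (inner ℂ p v).re := hp v
    have hξ (η) : polar Q (q, ξ) (0, η) = 0 := by
      simpa [polar, show Q' (0, 0) = 0 from Q'.map_zero] using hx 0 η 0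
    have hξ' (η) : polar Q' (q, ξ') (0, η) = 0 := by
      have := hx 0 0 η
      simp only [show ((0 : Cn n), (0 : Cn k)) = 0 from rfl,
        QuadraticMap.polar_zero_right] at this
      linarith
    have hp' (v) : polar Q' (q, ξ') (v, 0) = (inner ℂ p v).re := by
      rw [← hp]; linarith [hx v 0 0]
    obtain ⟨z, hz, hzp⟩ := h3 (q, ξ) p fun v η => by rw [polar_mk_add, hp, hξ, add_zero]
    obtain ⟨z', hz', hzp'⟩ := h3' (q, ξ') p fun v η => by rw [polar_mk_add, hp', hξ', add_zero]
    have hzz : z = z' := by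
      have e1 : z + A z = z' + A z' := by
        have := (h1 z).symm.trans ((congrArg Prod.fst hz).trans
          ((congrArg Prod.fst hz').symm.trans (h1' z')))
        simpa [-smul_add] using this
      have e2 : z - A z = z' - A z' := by simpa using hzp.trans hzp'.symm
      have : (2 : ℝ) • z = (2 : ℝ) • z' := by
        calc (2 : ℝ) • z = (z + A z) + (z - A z) := by module
          _ = (2 : ℝ) • z' := by rw [e1, e2]; module
      simpa using this
    subst hzz
    exact ⟨z, by rw [hτ, hz, hz']⟩
  · rintro ⟨z, rfl⟩ ⟨v, η, η'⟩
    rw [polar_fibreDifference, hτ]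
    have e : ((σ z).1, (σ' z).2) = σ' z := Prod.ext ((h1 z).trans (h1' z).symm) rfl
    simp only [e, Prod.mk.eta]
    rw [h2, h2', sub_self]

/-- The difference is the restriction of `S = Q ⊕ (-Q')` to equal base points. The pairs `(σ z, σ'
(z + z₀))` with `z₀` fixed by `A` form an isotropic space orthogonal to this restriction, so the
general bound applies to `S` and to `-S`. -/
lemma sigNeg_fibreDifference {Q : QuadraticForm ℝ (Cn n × Cn k)}
    {Q' : QuadraticForm ℝ (Cn n × Cn k')} {A : Cn n →L[ℝ] Cn n} (hA : IsSymplecticMap A)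
    (h : IsQuadraticGenerating Q A) (h' : IsQuadraticGenerating Q' A) :
    (sigNeg (fibreDifference Q Q') : ℤ) =
      Module.finrank ℝ (Cn k') + sigNeg Q - sigNeg Q' := by
  obtain ⟨σ, hinj, h1, h2, h3⟩ := h.exists_section
  obtain ⟨σ', hinj', h1', h2', h3'⟩ := h'.exists_section
  let K := LinearMap.ker (LinearMap.id - (A : Cn n →ₗ[ℝ] Cn n))
  let ι : Cn n × K →ₗ[ℝ] (Cn n × Cn k) × (Cn n × Cn k') :=
    (σ.comp (LinearMap.fst ℝ _ _)).prod
      (σ'.comp (LinearMap.fst ℝ _ _ + K.subtype.comp (LinearMap.snd ℝ _ _)))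
  have hι (z) : ι z = (σ z.1, σ' (z.1 + z.2)) := rfl
  have hιinj : Function.Injective ι := fun z w hzw => by
    simp only [hι, Prod.mk.injEq] at hzw
    have e1 := hinj hzw.1
    have e2 := hinj' hzw.2
    rw [e1] at e2
    exact Prod.ext e1 (Subtype.ext (by simpa using e2))
  have hK (z : K) : A z = z := by
    have := z.2
    simp only [K, LinearMap.mem_ker] at this
    exact (sub_eq_zero.1 this).symm
  let j : Cn n × (Cn k × Cn k') →ₗ[ℝ] (Cn n × Cn k) × (Cn n × Cn k') :=
    (((LinearMap.fst ℝ _ _).prod ((LinearMap.fst ℝ _ _).comp (LinearMap.snd ℝ _ _))).prod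
      ((LinearMap.fst ℝ _ _).prod ((LinearMap.snd ℝ _ _).comp (LinearMap.snd ℝ _ _))))
  have hj (x) : j x = ((x.1, x.2.1), (x.1, x.2.2)) := rfl
  have hjinj : Function.Injective j := fun x y hxy => by
    simp only [hj, Prod.mk.injEq] at hxy
    exact Prod.ext hxy.1.1 (Prod.ext hxy.1.2 hxy.2.2)
  have hS : fibreDifference Q Q' = (Q.prod (-Q')).comp j := rfl
  have hSneg : -(Q.prod (-Q')) = (-Q).prod Q' := by ext; simp; ring
  have hpS (x y : (Cn n × Cn k) × (Cn n × Cn k')) :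
      polar (Q.prod (-Q')) x y = polar Q x.1 y.1 - polar Q' x.2 y.2 := by
    simp [polar]; ring
  have hApp (z : Cn n) (z₀ : K) : z + z₀ - A (z + z₀) = z - A z := by
    rw [map_add, hK]; abel
  have hW : ∀ w ∈ LinearMap.range ι, (Q.prod (-Q')) w = 0 := by
    rintro _ ⟨⟨z, z₀⟩, rfl⟩
    have e : 2 * (Q.prod (-Q')) (ι (z, z₀)) = 0 := by
      have := QuadraticMap.polar_self (Q.prod (-Q')) (ι (z, z₀))
      rw [hpS, hι] at this
      rw [hι, two_mul, ← two_smul ℕ]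
      refine (this.symm.trans ?_)
      simp only
      nth_rw 2 [← Prod.mk.eta (p := σ z)]
      nth_rw 2 [← Prod.mk.eta (p := σ' (z + z₀))]
      rw [h2, h2', h1, h1', hApp, ← Complex.sub_re, ← inner_sub_right, ← stdForm_eq_re_inner]
      have : (2⁻¹ : ℝ) • (z + A z) - (2⁻¹ : ℝ) • (z + z₀ + A (z + z₀)) = (-1 : ℝ) • (z₀ : Cn n) := by
        rw [map_add, hK]; module
      rw [this]
      -- Symplecticity enters here: `Ω(Az, z₀) = Ω(Az, Az₀) = Ω(z, z₀)`.
      have e2 : stdForm (z - A z) (z₀ : Cn n) = 0 := by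
        have := hA z z₀
        rw [hK] at this
        simp only [stdForm, inner_sub_left, Complex.sub_im] at this ⊢
        linarith
      simp only [stdForm] at e2 ⊢
      rw [neg_smul, one_smul, inner_neg_right, Complex.neg_im, e2, neg_zero]
    linarith
  have hWj : ∀ w ∈ LinearMap.range ι, ∀ x, polar (Q.prod (-Q')) w (j x) = 0 := by
    rintro _ ⟨⟨z, z₀⟩, rfl⟩ x
    rw [hpS, hι, hj]
    simp only
    rw [h2, h2', hApp, sub_self]
  have b1 := sigPos_add_sigNeg_comp_add_finrank_le (Q.prod (-Q')) j hjinj _ hW hWj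
  have b2 := sigPos_add_sigNeg_comp_add_finrank_le (-(Q.prod (-Q'))) j hjinj (LinearMap.range ι)
    (fun w hw => by simp [hW w hw]) (fun w hw x => by
      rw [FunLike.coe_neg, QuadraticMap.polar_neg, hWj w hw, neg_zero])
  have hcn : (-(Q.prod (-Q'))).comp j = -((Q.prod (-Q')).comp j) := by ext; simp
  rw [hcn, sigNeg_neg, ← hS, hSneg] at b2
  rw [← hS] at b1
  have c1 := sigPos_add_sigPos_le_sigPos_prod Q (-Q')
  have c2 := sigPos_add_sigPos_le_sigPos_prod (-Q) Q'
  rw [LinearMap.finrank_range_of_inj hιinj] at b1 b2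
  have d1 := QuadraticForm.sigPos_add_sigNeg_add_radical (Q := Q)
  have d2 := QuadraticForm.sigPos_add_sigNeg_add_radical (Q := Q')
  have d3 := QuadraticForm.sigPos_add_sigNeg_add_radical (Q := fibreDifference Q Q')
  rw [h.finrank_radical] at d1
  rw [h'.finrank_radical] at d2
  rw [finrank_radical_fibreDifference h h'] at d3
  -- By the dimension formulas `d1`, `d2`, `d3`, the bounds `b1` and `b2`, weakened through `c1` and
  -- `c2`, add up to an equality; so each is an equality.
  simp only [Module.finrank_prod, sigPos_neg, K] at *
  omega

lemma IsGeneratingFamily.continuous_restrict {Γ : ℝ → (Cn n →L[ℝ] Cn n)}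
    {Q : ℝ → QuadraticForm ℝ (Cn n × Cn k)} (h : IsGeneratingFamily Q Γ) (x : Cn n × Cn k) :
    Continuous fun t : Icc (0 : ℝ) 1 => Q t x :=
  continuousOn_iff_continuous_domRestrict.1 (h.continuousOn x)

/-- The index variation of a generating family only depends on the path. -/
theorem IsGeneratingFamily.index_sub_eq {Γ : ℝ → (Cn n →L[ℝ] Cn n)}
    (hΓ : ∀ t ∈ Icc (0 : ℝ) 1, IsSymplecticMap (Γ t))
    {Q : ℝ → QuadraticForm ℝ (Cn n × Cn k)} (h : IsGeneratingFamily Q Γ)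
    {Q' : ℝ → QuadraticForm ℝ (Cn n × Cn k')} (h' : IsGeneratingFamily Q' Γ) :
    (sigNeg (Q 1) : ℤ) - sigNeg (Q 0) = sigNeg (Q' 1) - sigNeg (Q' 0) := by
  have h0 : (0 : ℝ) ∈ Icc (0 : ℝ) 1 := by simp
  have h1 : (1 : ℝ) ∈ Icc (0 : ℝ) 1 := by simp
  have : PreconnectedSpace (Icc (0 : ℝ) 1) := Subtype.preconnectedSpace isPreconnected_Icc
  have e := sigNeg_eq_of_finrank_radical_eq
    (Q := fun t : Icc (0 : ℝ) 1 => fibreDifference (Q t) (Q' t)) (fun x => by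
      simp only [fibreDifference_apply]
      exact (h.continuous_restrict _).sub (h'.continuous_restrict _))
    (fun t => finrank_radical_fibreDifference (h.generating t t.2) (h'.generating t t.2))
    ⟨0, h0⟩ ⟨1, h1⟩
  have e0 := sigNeg_fibreDifference (hΓ 0 h0) (h.generating 0 h0) (h'.generating 0 h0)
  have e1 := sigNeg_fibreDifference (hΓ 1 h1) (h.generating 1 h1) (h'.generating 1 h1)
  simp only at e
  omega

end GeneratingForms

/-! ### Existence: Cayley forms, composition and subdivision -/

section Existence

variable {n k k₁ k₂ : ℕ}

/-- The symplectic form of `ℂⁿ` as a bilinear form. -/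
def stdBilin (n : ℕ) : Cn n →ₗ[ℝ] Cn n →ₗ[ℝ] ℝ :=
  LinearMap.mk₂ ℝ stdForm
    (fun _ _ _ => by simp only [stdForm, inner_add_left, Complex.add_im])
    (fun c v w => by
      rw [← Complex.coe_smul, stdForm, inner_smul_left, Complex.conj_ofReal, Complex.im_ofReal_mul]
      rfl)
    (fun _ _ _ => by simp only [stdForm, inner_add_right, Complex.add_im])
    (fun c v w => by
      rw [← Complex.coe_smul, stdForm, inner_smul_right, Complex.im_ofReal_mul]
      rfl)

@[simp] lemma stdBilin_apply (v w : Cn n) : stdBilin n v w = stdForm v w := rfl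

lemma stdForm_add_left (u v w : Cn n) : stdForm (u + v) w = stdForm u w + stdForm v w :=
  (stdBilin n).map_add₂ u v w

lemma stdForm_add_right (u v w : Cn n) : stdForm u (v + w) = stdForm u v + stdForm u w :=
  map_add (stdBilin n u) v w

lemma stdForm_sub_left (u v w : Cn n) : stdForm (u - v) w = stdForm u w - stdForm v w :=
  (stdBilin n).map_sub₂ u v w

lemma stdForm_sub_right (u v w : Cn n) : stdForm u (v - w) = stdForm u v - stdForm u w :=
  map_sub (stdBilin n u) v w

lemma stdForm_smul_left (c : ℝ) (v w : Cn n) : stdForm (c • v) w = c * stdForm v w :=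
  (stdBilin n).map_smul₂ c v w

lemma stdForm_smul_right (c : ℝ) (v w : Cn n) : stdForm v (c • w) = c * stdForm v w :=
  map_smul (stdBilin n v) c w

@[simp] lemma stdForm_zero_left (w : Cn n) : stdForm 0 w = 0 := by simp [stdForm]

@[simp] lemma stdForm_zero_right (w : Cn n) : stdForm w 0 = 0 := by simp [stdForm]

lemma stdForm_comm (v w : Cn n) : stdForm v w = -stdForm w v := by
  rw [stdForm, stdForm, ← inner_conj_symm, Complex.conj_im]

lemma eq_of_stdForm_eq {u v : Cn n} (h : ∀ w, stdForm u w = stdForm v w) : u = v := by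
  have : Complex.I • u = Complex.I • v :=
    eq_of_re_inner_eq fun w => by rw [← stdForm_eq_re_inner, ← stdForm_eq_re_inner, h]
  exact (smul_right_inj Complex.I_ne_zero).1 this

lemma continuous_stdForm : Continuous fun p : Cn n × Cn n => stdForm p.1 p.2 := by
  unfold stdForm
  exact Complex.continuous_im.comp (continuous_fst.inner continuous_snd)

lemma IsSymplecticMap.isUnit {A : Cn n →L[ℝ] Cn n} (hA : IsSymplecticMap A) : IsUnit A := by
  rw [ContinuousLinearMap.isUnit_iff_bijective]
  have hinj : Function.Injective (A : Cn n →ₗ[ℝ] Cn n) := by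
    rw [← LinearMap.ker_eq_bot, LinearMap.ker_eq_bot']
    intro v hv
    refine eq_of_stdForm_eq fun w => ?_
    rw [← hA, show A v = 0 from hv]; simp
  exact ⟨hinj, LinearMap.injective_iff_surjective.1 hinj⟩

lemma IsSymplecticMap.mul {A B : Cn n →L[ℝ] Cn n} (hA : IsSymplecticMap A)
    (hB : IsSymplecticMap B) : IsSymplecticMap (A * B) := fun v w => by
  rw [mul_apply_eq_comp, mul_apply_eq_comp, hA, hB]

lemma IsSymplecticMap.inverse {A : Cn n →L[ℝ] Cn n} (hA : IsSymplecticMap A) :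
    IsSymplecticMap (Ring.inverse A) := fun v w => by
  have h (v) : A (Ring.inverse A v) = v := by
    rw [← mul_apply_eq_comp, Ring.mul_inverse_cancel _ hA.isUnit]; rfl
  rw [← hA, h, h]

/-- Writing the covector `p` as `Ω(u, ·)` with `u = -ip` removes the factor `i` from the Lagrangian,
and regularity is tested in its dual form. -/
lemma IsQuadraticGenerating.of_polar {Q : QuadraticForm ℝ (Cn n × Cn k)} {A : Cn n →L[ℝ] Cn n}
    (h0 : ∀ ξ : Cn k, (∀ x, polar Q x (0, ξ) = 0) → ξ = 0)
    (h1 : ∀ x u, (∀ v η, polar Q x (v, η) = stdForm u v) →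
      ∃ z, x.1 = (2⁻¹ : ℝ) • (z + A z) ∧ u = z - A z)
    (h2 : ∀ z, ∃ ξ, ∀ v η, polar Q ((2⁻¹ : ℝ) • (z + A z), ξ) (v, η) = stdForm (z - A z) v) :
    IsQuadraticGenerating Q A := by
  refine ⟨surjective_fibreDerivative h0, ?_⟩
  ext ⟨q, p⟩
  constructor
  · rintro ⟨x, hx, hq, hp⟩
    have hI : Complex.I • (-Complex.I • p) = p := by simp [smul_smul]
    obtain ⟨z, hz1, hz2⟩ := h1 x (-Complex.I • p) fun v η => by
      rw [polar_mk_add, hx, hp, add_zero, stdForm_eq_re_inner, hI]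
    refine ⟨z, Prod.ext (hz1.symm.trans hq) ?_⟩
    change Complex.I • (z - A z) = p
    rw [← hz2, hI]
  · rintro ⟨z, hz⟩
    have hz1 : (2⁻¹ : ℝ) • (z + A z) = q := congrArg Prod.fst hz
    have hz2 : Complex.I • (z - A z) = p := congrArg Prod.snd hz
    obtain ⟨ξ, hξ⟩ := h2 z
    refine ⟨(q, ξ), fun η => ?_, rfl, fun v => ?_⟩
    · rw [← hz1, hξ]; simp
    · rw [← hz1, hξ, ← hz2, stdForm_eq_re_inner]

lemma IsQuadraticGenerating.exists_section_stdForm {Q : QuadraticForm ℝ (Cn n × Cn k)}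
    {A : Cn n →L[ℝ] Cn n} (h : IsQuadraticGenerating Q A) :
    ∃ σ : Cn n →ₗ[ℝ] Cn n × Cn k, (∀ z, (σ z).1 = (2⁻¹ : ℝ) • (z + A z)) ∧
      (∀ z v η, polar Q (σ z) (v, η) = stdForm (z - A z) v) ∧
      ∀ x u, (∀ v η, polar Q x (v, η) = stdForm u v) → ∃ z, σ z = x ∧ z - A z = u := by
  obtain ⟨σ, -, h1, h2, h3⟩ := h.exists_section
  refine ⟨σ, h1, fun z v η => by rw [h2, stdForm_eq_re_inner], fun x u hx => ?_⟩
  obtain ⟨z, hz, hz'⟩ := h3 x (Complex.I • u) fun v η => by rw [hx, stdForm_eq_re_inner]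
  exact ⟨z, hz, (smul_right_inj Complex.I_ne_zero).1 hz'⟩

/-- The generating function of a symplectic map `B` with `C = (1 + B)⁻¹`. -/
def cayleyForm (B C : Cn n →L[ℝ] Cn n) : QuadraticForm ℝ (Cn n × Cn 0) :=
  LinearMap.BilinMap.toQuadraticMap ((stdBilin n).compl₁₂
    (((1 - B) * C : Cn n →L[ℝ] Cn n).toLinearMap.comp (LinearMap.fst ℝ _ _)) (LinearMap.fst ℝ _ _))

lemma cayleyForm_apply (B C : Cn n →L[ℝ] Cn n) (x : Cn n × Cn 0) :
    cayleyForm B C x = stdForm (((1 - B) * C : Cn n →L[ℝ] Cn n) x.1) x.1 := rfl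

/-- At `q = (z + Bz)/2` one has `(1 - B)Cq = (z - Bz)/2`. Symplecticity of `B` makes the bilinear
form `Ω((1 - B)C·, ·)` symmetric, so the derivative at `q` is `Ω(z - Bz, ·)`. -/
lemma isQuadraticGenerating_cayleyForm {B C : Cn n →L[ℝ] Cn n} (hB : IsSymplecticMap B)
    (h1 : (1 + B) * C = 1) (h2 : C * (1 + B) = 1) :
    IsQuadraticGenerating (cayleyForm B C) B := by
  have hC (z) : C (z + B z) = z := congrArg (fun D : Cn n →L[ℝ] Cn n => D z) h2
  have hC' (z) : C z + B (C z) = z := congrArg (fun D : Cn n →L[ℝ] Cn n => D z) h1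
  have hpol (x y : Cn n × Cn 0) : polar (cayleyForm B C) x y =
      stdForm (C x.1 - B (C x.1)) y.1 + stdForm (C y.1 - B (C y.1)) x.1 := by
    simp only [polar, cayleyForm_apply, Prod.fst_add, mul_apply_eq_comp, map_add,
      stdForm_add_left, stdForm_add_right, sub_apply, one_apply_eq_self, stdForm_sub_left]
    ring
  have hp (z v : Cn n) (ξ η) : polar (cayleyForm B C) ((2⁻¹ : ℝ) • (z + B z), ξ) (v, η) =
      stdForm (z - B z) v := by
    rw [hpol]
    simp only [map_smul, hC]
    obtain ⟨y, rfl⟩ : ∃ y, v = y + B y := ⟨C v, (hC' v).symm⟩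
    rw [hC]
    have := hB y z
    simp only [stdForm_sub_left, stdForm_smul_left, stdForm_add_right, stdForm_smul_right]
    linarith [stdForm_comm y z, stdForm_comm y (B z), stdForm_comm (B y) z,
      stdForm_comm (B y) (B z)]
  refine .of_polar (fun ξ _ => Subsingleton.elim _ _) (fun x u hx => ?_) (fun z => ?_)
  · have e : x.1 = (2⁻¹ : ℝ) • ((2 : ℝ) • C x.1 + B ((2 : ℝ) • C x.1)) := by
      rw [map_smul, ← smul_add, hC', smul_smul]; norm_num
    refine ⟨(2 : ℝ) • C x.1, e, eq_of_stdForm_eq fun v => ?_⟩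
    rw [← hx v 0, ← hp _ v x.2 0, ← e]
  · exact ⟨0, fun v η => hp z v 0 η⟩

/-- A generating function of `B ∘ A` built from generating functions of `A` and `B`. -/
def compForm (Q₁ : QuadraticForm ℝ (Cn n × Cn k₁)) (Q₂ : QuadraticForm ℝ (Cn n × Cn k₂))
    (e : Cn k ≃ₗ[ℝ] (Cn n × Cn k₁) × (Cn n × Cn k₂)) : QuadraticForm ℝ (Cn n × Cn k) :=
  let x₁ := (LinearMap.fst ℝ _ _).comp (e.toLinearMap.comp (LinearMap.snd ℝ (Cn n) (Cn k)))
  let x₂ := (LinearMap.snd ℝ _ _).comp (e.toLinearMap.comp (LinearMap.snd ℝ (Cn n) (Cn k)))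
  Q₁.comp x₁ + Q₂.comp x₂ - (2 : ℝ) • LinearMap.BilinMap.toQuadraticMap ((stdBilin n).compl₁₂
    ((LinearMap.fst ℝ _ _).comp x₁ - LinearMap.fst ℝ _ _)
    ((LinearMap.fst ℝ _ _).comp x₂ - LinearMap.fst ℝ _ _))

lemma compForm_apply (Q₁ : QuadraticForm ℝ (Cn n × Cn k₁)) (Q₂ : QuadraticForm ℝ (Cn n × Cn k₂))
    (e : Cn k ≃ₗ[ℝ] (Cn n × Cn k₁) × (Cn n × Cn k₂)) (x : Cn n × Cn k) :
    compForm Q₁ Q₂ e x = Q₁ (e x.2).1 + Q₂ (e x.2).2 -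
      2 * stdForm ((e x.2).1.1 - x.1) ((e x.2).2.1 - x.1) := rfl

lemma polar_compForm (Q₁ : QuadraticForm ℝ (Cn n × Cn k₁)) (Q₂ : QuadraticForm ℝ (Cn n × Cn k₂))
    (e : Cn k ≃ₗ[ℝ] (Cn n × Cn k₁) × (Cn n × Cn k₂)) (x y : Cn n × Cn k) :
    polar (compForm Q₁ Q₂ e) x y = polar Q₁ (e x.2).1 (e y.2).1 + polar Q₂ (e x.2).2 (e y.2).2 -
      2 * (stdForm ((e x.2).1.1 - x.1) ((e y.2).2.1 - y.1) +
        stdForm ((e y.2).1.1 - y.1) ((e x.2).2.1 - x.1)) := by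
  simp only [polar, compForm_apply, Prod.fst_add, Prod.snd_add, map_add, stdForm_sub_left,
    stdForm_sub_right, stdForm_add_left, stdForm_add_right]
  ring

/-- Let `q₁`, `q₂` be the base components of `σ₁ z`, `σ₂ y`. Criticality along the fibre reads `z -
Az = 2(q - q₂)` and `y - By = 2(q₁ - q)`. Since `2q₁ = z + Az` and `2q₂ = y + By`, this forces `y =
Az` and `2q = z + BAz`; the remaining derivative is `Ω(2(q₁ - q₂), ·) = Ω(z - BAz, ·)`. -/
lemma isQuadraticGenerating_compForm {Q₁ : QuadraticForm ℝ (Cn n × Cn k₁)}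
    {Q₂ : QuadraticForm ℝ (Cn n × Cn k₂)} {A B : Cn n →L[ℝ] Cn n}
    (hA : IsQuadraticGenerating Q₁ A) (hB : IsQuadraticGenerating Q₂ B)
    (e : Cn k ≃ₗ[ℝ] (Cn n × Cn k₁) × (Cn n × Cn k₂)) :
    IsQuadraticGenerating (compForm Q₁ Q₂ e) (B * A) := by
  obtain ⟨σ₁, a1, a2, a3⟩ := hA.exists_section_stdForm
  obtain ⟨σ₂, b1, b2, b3⟩ := hB.exists_section_stdForm
  have key (x : Cn n × Cn k) (u) (hx : ∀ v η, polar (compForm Q₁ Q₂ e) x (v, η) = stdForm u v) :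
      ∃ z, σ₁ z = (e x.2).1 ∧ σ₂ (A z) = (e x.2).2 ∧ x.1 = (2⁻¹ : ℝ) • (z + B (A z)) ∧
        u = z - B (A z) := by
    obtain ⟨z, hz, hz'⟩ := a3 (e x.2).1 ((-2 : ℝ) • ((e x.2).2.1 - x.1)) fun v η => by
      have := hx 0 (e.symm ((v, η), 0))
      simp only [polar_compForm, LinearEquiv.apply_symm_apply, QuadraticMap.polar_zero_right,
        Prod.fst_zero, sub_zero, stdForm_zero_right] at this
      rw [stdForm_smul_left, stdForm_comm _ v]
      linarith
    obtain ⟨y, hy, hy'⟩ := b3 (e x.2).2 ((2 : ℝ) • ((e x.2).1.1 - x.1)) fun v η => by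
      have := hx 0 (e.symm (0, (v, η)))
      simp only [polar_compForm, LinearEquiv.apply_symm_apply, QuadraticMap.polar_zero_right,
        Prod.fst_zero, sub_zero, stdForm_zero_right, stdForm_zero_left] at this
      rw [stdForm_smul_left]
      linarith
    have hu : u = (2 : ℝ) • ((e x.2).1.1 - (e x.2).2.1) := eq_of_stdForm_eq fun v => by
      rw [← hx v 0, polar_compForm]
      simp only [map_zero, QuadraticMap.polar_zero_right, Prod.fst_zero,
        Prod.snd_zero, stdForm_sub_left, stdForm_smul_left, stdForm_sub_right, stdForm_zero_left,
        stdForm_zero_right]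
      linarith [stdForm_comm v (e x.2).2.1, stdForm_comm v x.1]
    have e1 := a1 z
    have e2 := b1 y
    rw [hz] at e1
    rw [hy] at e2
    rw [e2] at hz'
    rw [e1] at hy'
    have hyz : y = A z := by
      linear_combination (norm := module) (2⁻¹ : ℝ) • hz' + (2⁻¹ : ℝ) • hy'
    subst hyz
    refine ⟨z, hz, hy, ?_, ?_⟩
    · linear_combination (norm := module) (2⁻¹ : ℝ) • hy'
    · rw [hu, e1, e2]; module
  refine .of_polar (fun ξ hξ => ?_) (fun x u hx => ?_) (fun z => ?_)
  · obtain ⟨z, hz1, hz2, hz3, hz4⟩ := key (0, ξ) 0 fun v η => by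
      rw [polar_comm, hξ, stdForm_zero_left]
    have hz : z = 0 := by
      linear_combination (norm := module) (-1 : ℝ) • hz3 - (2⁻¹ : ℝ) • hz4
    have h0 : e ξ = 0 := Prod.ext (by rw [← hz1, hz]; simp) (by rw [← hz2, hz]; simp)
    simpa using h0
  · obtain ⟨z, -, -, h⟩ := key x u hx
    exact ⟨z, h⟩
  · refine ⟨e.symm (σ₁ z, σ₂ (A z)), fun v η => ?_⟩
    rw [polar_compForm]
    simp only [LinearEquiv.apply_symm_apply, mul_apply_eq_comp]
    obtain ⟨⟨v₁, η₁⟩, ⟨v₂, η₂⟩⟩ := e η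
    rw [a2, b2, a1, b1]
    simp only [stdForm_sub_left, stdForm_sub_right, stdForm_smul_left, stdForm_add_left,
      stdForm_add_right, stdForm_smul_right]
    simp only [stdForm_comm _ (A z), stdForm_comm _ z, stdForm_comm _ (B (A z))]
    ring

/-- The fibre of a composed generating function absorbs both base variables and must again be
presented as some `ℂᵏ`. -/
lemma exists_linearEquiv_fibre (n k₁ k₂ : ℕ) :
    ∃ k, Nonempty (Cn k ≃ₗ[ℝ] (Cn n × Cn k₁) × (Cn n × Cn k₂)) :=
  ⟨(n + k₁) + (n + k₂), ⟨(LinearEquiv.ofFinrankEq (R := ℂ) (Cn ((n + k₁) + (n + k₂)))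
    ((Cn n × Cn k₁) × (Cn n × Cn k₂)) (by simp)).restrictScalars ℝ⟩⟩

lemma continuous_inverse_of_isUnit {T R : Type*} [TopologicalSpace T] [NormedRing R]
    [HasSummableGeomSeries R] {f : T → R} (hf : Continuous f) (hu : ∀ t, IsUnit (f t)) :
    Continuous fun t => Ring.inverse (f t) :=
  continuous_iff_continuousAt.2 fun t => ContinuousAt.comp (g := Ring.inverse) (by
    obtain ⟨u, hu⟩ := hu t
    rw [← hu]
    exact NormedRing.inverse_continuousAt u) hf.continuousAt

section Family

variable {T : Type*} [TopologicalSpace T]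

/-- A family of linear maps is generated by a continuous family of quadratic forms. -/
def HasGeneratingFamily (A : T → (Cn n →L[ℝ] Cn n)) : Prop :=
  ∃ (k : ℕ) (Q : T → QuadraticForm ℝ (Cn n × Cn k)), (∀ x, Continuous fun t => Q t x) ∧
    ∀ t, IsQuadraticGenerating (Q t) (A t)

lemma hasGeneratingFamily_of_isUnit_one_add {B : T → (Cn n →L[ℝ] Cn n)} (hB : Continuous B)
    (hs : ∀ t, IsSymplecticMap (B t)) (hu : ∀ t, IsUnit (1 + B t)) : HasGeneratingFamily B := by
  refine ⟨0, fun t => cayleyForm (B t) (Ring.inverse (1 + B t)), fun x => ?_, fun t =>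
    isQuadraticGenerating_cayleyForm (hs t) (Ring.mul_inverse_cancel _ (hu t))
      (Ring.inverse_mul_cancel _ (hu t))⟩
  have hc : Continuous fun t => Ring.inverse (1 + B t) :=
    continuous_inverse_of_isUnit (continuous_const.add hB) hu
  simp only [cayleyForm_apply]
  exact continuous_stdForm.comp ((((continuous_const.sub hB).mul hc).clm_apply
    continuous_const).prodMk continuous_const)

lemma HasGeneratingFamily.mul {A B : T → (Cn n →L[ℝ] Cn n)} (hB : HasGeneratingFamily B)
    (hA : HasGeneratingFamily A) : HasGeneratingFamily fun t => B t * A t := by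
  obtain ⟨k₁, Q₁, c₁, g₁⟩ := hA
  obtain ⟨k₂, Q₂, c₂, g₂⟩ := hB
  obtain ⟨k, ⟨e⟩⟩ := exists_linearEquiv_fibre n k₁ k₂
  refine ⟨k, fun t => compForm (Q₁ t) (Q₂ t) e, fun x => ?_, fun t =>
    isQuadraticGenerating_compForm (g₁ t) (g₂ t) e⟩
  simp only [compForm_apply]
  exact ((c₁ _).add (c₂ _)).sub continuous_const

end Family

/-- Neumann series for `1 + b = 2(1 - (1 - b)/2)`. -/
lemma isUnit_one_add_of_norm_sub_one_lt {R : Type*} [NormedRing R] [NormedAlgebra ℝ R]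
    [HasSummableGeomSeries R] {b : R} (hb : ‖b - 1‖ < 1) : IsUnit (1 + b) := by
  have h : IsUnit (1 - (2⁻¹ : ℝ) • (1 - b)) := isUnit_one_sub_of_norm_lt_one (by
    rw [norm_smul, norm_sub_rev]
    norm_num
    linarith)
  have e : 1 + b = Units.mk0 (2 : ℝ) two_ne_zero • (1 - (2⁻¹ : ℝ) • (1 - b)) := by
    rw [Units.smul_mk0]
    module
  rw [e]
  exact h.smul _

/-- The quotient `G(s, t') G(s, t)⁻¹` is uniformly continuous by compactness and equals `1` when `t
= t'`. -/
lemma exists_subdivision {R : Type*} [NormedRing R]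
    [HasSummableGeomSeries R] {S : Type*} [PseudoMetricSpace S] [CompactSpace S]
    {G : S × unitInterval → R} (hG : Continuous G) (hu : ∀ p, IsUnit (G p)) :
    ∃ δ > 0, ∀ s t t', dist t t' < δ → ‖G (s, t') * Ring.inverse (G (s, t)) - 1‖ < 1 := by
  have hc : Continuous fun p => Ring.inverse (G p) := continuous_inverse_of_isUnit hG hu
  have hK : UniformContinuous fun q : S × unitInterval × unitInterval =>
      G (q.1, q.2.2) * Ring.inverse (G (q.1, q.2.1)) := by
    apply CompactSpace.uniformContinuous_of_continuous
    exact (hG.comp (by fun_prop)).mul (hc.comp (by fun_prop))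
  obtain ⟨δ, hδ, h⟩ := Metric.uniformContinuous_iff.1 hK 1 one_pos
  refine ⟨δ, hδ, fun s t t' htt => ?_⟩
  have := @h (s, t, t') (s, t, t) (by
    simpa [Prod.dist_eq, hδ, dist_comm] using htt)
  simpa [dist_eq_norm, Ring.mul_inverse_cancel _ (hu (s, t))] using this

/-- A homotopy of symplectic paths starting at the identity has a continuous family of quadratic
generating functions. -/
theorem hasGeneratingFamily_of_homotopy {S : Type*} [PseudoMetricSpace S] [CompactSpace S]
    {G : S × unitInterval → (Cn n →L[ℝ] Cn n)} (hG : Continuous G)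
    (hs : ∀ p, IsSymplecticMap (G p)) (h0 : ∀ s, G (s, 0) = 1) : HasGeneratingFamily G := by
  obtain ⟨δ, hδ, h⟩ := exists_subdivision hG fun p => (hs p).isUnit
  obtain ⟨N, hN⟩ := exists_nat_one_div_lt hδ
  -- The projection onto the interval only acts for `j > N + 1`.
  let r (j : ℕ) : unitInterval := projIcc 0 1 zero_le_one (j / ((N : ℝ) + 1))
  have hr (j : ℕ) : dist (r j) (r (j + 1)) < δ := by
    refine lt_of_le_of_lt ?_ hN
    refine (LipschitzWith.projIcc (zero_le_one (α := ℝ))).dist_le_mul _ _ |>.trans ?_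
    rw [Real.dist_eq, Nat.cast_add, ← sub_div, Nat.cast_one, sub_add_cancel_left, abs_div, abs_neg,
      abs_one, NNReal.coe_one, one_mul, abs_of_pos (by positivity)]
  have hrd (j : ℕ) (t : unitInterval) : dist (r j * t) (r (j + 1) * t) < δ := by
    refine lt_of_le_of_lt ?_ (hr j)
    rw [Subtype.dist_eq, Subtype.dist_eq, Real.dist_eq, Real.dist_eq]
    simp only [Set.Icc.coe_mul]
    rw [← sub_mul, abs_mul, abs_of_nonneg t.2.1]
    exact mul_le_of_le_one_right (abs_nonneg _) t.2.2
  -- Rescaling time to `r j * t`, instead of truncating it, keeps the parameter space `S × [0, 1]`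
  -- fixed: each induction step composes with one more factor close to the identity over all of it.
  have key (j : ℕ) : HasGeneratingFamily fun p : S × unitInterval => G (p.1, r j * p.2) := by
    induction j with
    | zero =>
      have : r 0 = 0 := by simp [r]
      simp only [this, zero_mul, h0]
      refine hasGeneratingFamily_of_isUnit_one_add continuous_const (fun _ _ _ => rfl) fun _ => ?_
      exact isUnit_one_add_of_norm_sub_one_lt (by simp)
    | succ j ih =>
      have e : (fun p : S × unitInterval => G (p.1, r (j + 1) * p.2)) = fun p =>
          (G (p.1, r (j + 1) * p.2) * Ring.inverse (G (p.1, r j * p.2))) * G (p.1, r j * p.2) := by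
        funext p
        rw [mul_assoc, Ring.inverse_mul_cancel _ (hs _).isUnit, mul_one]
      rw [e]
      refine (hasGeneratingFamily_of_isUnit_one_add ?_ (fun p => (hs _).mul (hs _).inverse)
        fun p => ?_).mul ih
      · exact (hG.comp (by fun_prop)).mul (continuous_inverse_of_isUnit (hG.comp (by fun_prop))
          fun p => (hs _).isUnit)
      · exact isUnit_one_add_of_norm_sub_one_lt (h _ _ _ (hrd j p.2))
  have h1 : r (N + 1) = 1 := by
    simp [r, div_self (by positivity : (N : ℝ) + 1 ≠ 0)]
  simpa only [h1, one_mul] using key (N + 1)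

end Existence

/-! ### The Maslov index: existence, homotopy invariance, stabilization -/

section MaslovIndex

variable {n k : ℕ}

lemma IsGeneratingFamily.hasMaslovIndex {Γ : ℝ → (Cn n →L[ℝ] Cn n)}
    {Q : ℝ → QuadraticForm ℝ (Cn n × Cn k)} (h : IsGeneratingFamily Q Γ)
    (hc : ContinuousOn Γ (Icc 0 1)) (hs : ∀ t ∈ Icc (0 : ℝ) 1, IsSymplecticMap (Γ t)) :
    HasMaslovIndex Γ ((sigNeg (Q 1) : ℤ) - sigNeg (Q 0)) where
  continuousOn := hc
  symplectic := hs
  exists_family := ⟨k, Q, h⟩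
  index_eq _ _ h' := h'.index_sub_eq hs h

lemma isGeneratingFamily_comp_projIcc {S : Type*} [TopologicalSpace S]
    {Γ : ℝ → (Cn n →L[ℝ] Cn n)} {A : S → (Cn n →L[ℝ] Cn n)} {Q : S → QuadraticForm ℝ (Cn n × Cn k)}
    (hc : ∀ x, Continuous fun s => Q s x) (hQ : ∀ s, IsQuadraticGenerating (Q s) (A s))
    {f : unitInterval → S} (hf : Continuous f) (hΓ : ∀ t : unitInterval, Γ t = A (f t)) :
    IsGeneratingFamily (fun t => Q (f (projIcc 0 1 zero_le_one t))) Γ where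
  continuousOn x := ((hc x).comp (hf.comp continuous_projIcc)).continuousOn
  generating t ht := by
    rw [projIcc_of_mem zero_le_one ht, hΓ ⟨t, ht⟩]
    exact hQ _

/-- A path is a homotopy with a one-point parameter space. -/
theorem exists_hasMaslovIndex {Γ : ℝ → (Cn n →L[ℝ] Cn n)} (hc : ContinuousOn Γ (Icc 0 1))
    (hs : ∀ t ∈ Icc (0 : ℝ) 1, IsSymplecticMap (Γ t)) (h0 : Γ 0 = 1) :
    ∃ m, HasMaslovIndex Γ m := by
  obtain ⟨k, Q, hQc, hQ⟩ := hasGeneratingFamily_of_homotopy (S := Unit)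
    (G := fun p : Unit × unitInterval => Γ p.2)
    ((continuousOn_iff_continuous_domRestrict.1 hc).comp continuous_snd)
    (fun p => hs p.2 p.2.2) (fun _ => h0)
  exact ⟨_, (isGeneratingFamily_comp_projIcc hQc hQ (f := fun t => ((), t)) (by fun_prop)
    fun t => rfl).hasMaslovIndex hc hs⟩

/-- The Maslov index is invariant under homotopies with fixed end points. -/
theorem HasMaslovIndex.of_homotopy {Γ Γ' : ℝ → (Cn n →L[ℝ] Cn n)} {m : ℤ}
    (hm : HasMaslovIndex Γ m) {H : unitInterval × unitInterval → (Cn n →L[ℝ] Cn n)}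
    (hH : Continuous H) (hs : ∀ p, IsSymplecticMap (H p)) (h0 : ∀ s, H (s, 0) = 1)
    (h1 : ∀ s, H (s, 1) = Γ 1) (hΓ : ∀ t : unitInterval, Γ t = H (0, t))
    (hΓ' : ∀ t : unitInterval, Γ' t = H (1, t)) : HasMaslovIndex Γ' m := by
  obtain ⟨k, Q, hQc, hQ⟩ := hasGeneratingFamily_of_homotopy hH hs h0
  have f0 := isGeneratingFamily_comp_projIcc hQc hQ (f := fun t => (0, t)) (by fun_prop) hΓ
  have f1 := isGeneratingFamily_comp_projIcc hQc hQ (f := fun t => (1, t)) (by fun_prop) hΓ'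
  -- At an end point the path in `s` is constant, hence also generated by a constant family, whose
  -- index variation is zero.
  have hconst (t : unitInterval) (B : Cn n →L[ℝ] Cn n) (hB : ∀ s, H (s, t) = B) :
      sigNeg (Q (1, t)) = sigNeg (Q (0, t)) := by
    have e := (isGeneratingFamily_comp_projIcc hQc hQ (f := fun s => (s, t)) (Γ := fun _ => B)
      (by fun_prop) fun s => (hB s).symm).index_sub_eq (fun _ _ => hB 0 ▸ hs (0, t))
      (Q' := fun _ => Q (0, t)) ⟨fun _ => continuousOn_const, fun _ _ => hB 0 ▸ hQ (0, t)⟩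
    have p0 : projIcc (0 : ℝ) 1 zero_le_one 0 = 0 := projIcc_left _
    have p1 : projIcc (0 : ℝ) 1 zero_le_one 1 = 1 := projIcc_right _
    simp only [p0, p1] at e
    omega
  have hc' : ContinuousOn Γ' (Icc 0 1) := by
    rw [continuousOn_iff_continuous_domRestrict]
    exact (hH.comp (f := fun t : unitInterval => ((1 : unitInterval), t)) (by fun_prop)).congr
      fun t => (hΓ' t).symm
  have e := f1.hasMaslovIndex hc' fun t ht => by rw [hΓ' ⟨t, ht⟩]; exact hs _
  have e0 := hm.index_eq _ _ f0
  have p0 : projIcc (0 : ℝ) 1 zero_le_one 0 = 0 := projIcc_left _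
  have p1 : projIcc (0 : ℝ) 1 zero_le_one 1 = 1 := projIcc_right _
  simp only [p0, p1, hconst 0 1 h0, hconst 1 _ h1] at e e0
  rwa [e0] at e

variable {d : ℕ}

/-- If `B` is the direct sum of `A` on a symplectic subspace `ι(ℂᵈ)` and of the identity on the
symplectic complement `ker ρ`, then a generating function of `A` generates `B` as well. -/
lemma IsQuadraticGenerating.comp_prodMap {Q : QuadraticForm ℝ (Cn d × Cn k)}
    {A : Cn d →L[ℝ] Cn d} (h : IsQuadraticGenerating Q A) {B : Cn n →L[ℝ] Cn n}
    {ι : Cn d →L[ℝ] Cn n} {ρ : Cn n →L[ℝ] Cn d} (hρι : ∀ a, ρ (ι a) = a)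
    (hι : ∀ a w, stdForm (ι a) w = stdForm a (ρ w)) (hB : ∀ a, B (ι a) = ι (A a))
    (hBρ : ∀ w, ρ w = 0 → B w = w) :
    IsQuadraticGenerating (Q.comp (ρ.toLinearMap.prodMap LinearMap.id)) B := by
  obtain ⟨σ, h1, h2, h3⟩ := h.exists_section_stdForm
  have hpol (x y : Cn n × Cn k) : polar (Q.comp (ρ.toLinearMap.prodMap LinearMap.id)) x y =
      polar Q (ρ x.1, x.2) (ρ y.1, y.2) := by
    simp [polar]
  have hBz (z : Cn n) : B z = ι (A (ρ z)) + (z - ι (ρ z)) := by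
    have := hBρ (z - ι (ρ z)) (by rw [map_sub, hρι, sub_self])
    rw [← hB]
    rw [map_sub] at this
    rw [← this]; abel
  have hρB (z) : ρ (B z) = A (ρ z) := by
    rw [hBz, map_add, map_sub, hρι, hρι, sub_self, add_zero]
  refine .of_polar (fun ξ hξ => h.eq_zero_of_polar fun x => ?_) (fun x u hx => ?_) fun z => ?_
  · simpa [hpol, hρι] using hξ (ι x.1, x.2)
  · obtain ⟨a, ha, ha'⟩ := h3 (ρ x.1, x.2) (ρ u) fun v η => by
      have := hx (ι v) η
      rw [hpol] at this
      simp only [hρι] at this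
      rw [this, stdForm_comm, hι, ← stdForm_comm]
    have hu : u = ι (ρ u) := eq_of_stdForm_eq fun v => by
      rw [hι, ← hx v 0, hpol, ← ha, h2, ha']
    have hx1 : ρ x.1 = (2⁻¹ : ℝ) • (a + A a) := by rw [← h1, ha]
    have hz : ρ (ι a + (x.1 - ι (ρ x.1))) = a := by
      rw [map_add, map_sub, hρι, hρι, sub_self, add_zero]
    -- The component of `x.1` in `ker ρ` is fixed by `B`: it passes unchanged to the half-sum and
    -- cancels in the difference.
    refine ⟨ι a + (x.1 - ι (ρ x.1)), ?_, ?_⟩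
    · rw [hBz, hz, hx1]
      simp only [map_add, map_smul]
      module
    · rw [hBz, hz, hu, ← ha']
      simp only [map_sub]
      abel
  · refine ⟨(σ (ρ z)).2, fun v η => ?_⟩
    have e : (ρ ((2⁻¹ : ℝ) • (z + B z)), (σ (ρ z)).2) = σ (ρ z) :=
      Prod.ext (by rw [h1, map_smul, map_add, hρB]) rfl
    rw [hpol, e, h2, ← hι, hBz]
    congr 1
    simp only [map_sub]
    abel

/-- A generating family of `γ`, pulled back by `ρ`, generates `Γ`, and pulling back by a surjection
preserves the index. -/
lemma HasMaslovIndex.of_stabilization {γ : ℝ → (Cn d →L[ℝ] Cn d)} {Γ : ℝ → (Cn n →L[ℝ] Cn n)}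
    {m : ℤ} (hΓ : HasMaslovIndex Γ m) (hc : ContinuousOn γ (Icc 0 1))
    (hs : ∀ t ∈ Icc (0 : ℝ) 1, IsSymplecticMap (γ t)) (h0 : γ 0 = 1)
    {ι : Cn d →L[ℝ] Cn n} {ρ : Cn n →L[ℝ] Cn d} (hρι : ∀ a, ρ (ι a) = a)
    (hι : ∀ a w, stdForm (ι a) w = stdForm a (ρ w))
    (hB : ∀ t ∈ Icc (0 : ℝ) 1, ∀ a, Γ t (ι a) = ι (γ t a))
    (hBρ : ∀ t ∈ Icc (0 : ℝ) 1, ∀ w, ρ w = 0 → Γ t w = w) : HasMaslovIndex γ m := by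
  obtain ⟨m', hm'⟩ := exists_hasMaslovIndex hc hs h0
  obtain ⟨k, Q, hQ⟩ := hm'.exists_family
  have e := hΓ.index_eq k (fun t => (Q t).comp (ρ.toLinearMap.prodMap LinearMap.id))
    ⟨fun x => hQ.continuousOn _, fun t ht => (hQ.generating t ht).comp_prodMap hρι hι (hB t ht)
      (hBρ t ht)⟩
  have hsurj : Function.Surjective (ρ.toLinearMap.prodMap (LinearMap.id (R := ℝ) (M := Cn k))) :=
    fun x => ⟨(ι x.1, x.2), Prod.ext (hρι x.1) rfl⟩
  rw [sigNeg_comp_of_surjective _ _ hsurj, sigNeg_comp_of_surjective _ _ hsurj,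
    hm'.index_eq k Q hQ] at e
  rwa [← e]

end MaslovIndex

end MaslovLift

namespace MaslovLift

open Filter Topology

/-! ### Differentials of an equivariant Hamiltonian flow -/

section Flow

variable {n : ℕ} {Φ : ℝ → (Cn n ≃ₜ Cn n)}

lemma uniqueDiffOn_Icc_prod_compl :
    UniqueDiffOn ℝ (Icc (0 : ℝ) 1 ×ˢ ({0}ᶜ : Set (Cn n))) :=
  (uniqueDiffOn_Icc zero_lt_one).prod isOpen_compl_singleton.uniqueDiffOn

namespace IsEquivariantHamiltonianFlow

lemma map_ne_zero (h : IsEquivariantHamiltonianFlow Φ) {t : ℝ} (ht : t ∈ Icc (0 : ℝ) 1)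
    {z : Cn n} (hz : z ≠ 0) : Φ t z ≠ 0 := by
  have h0 : Φ t 0 = 0 := by simpa using h.equivariant t ht 0 0
  exact fun h1 => hz ((Φ t).injective (h1.trans h0.symm))

lemma hasFDerivAt (h : IsEquivariantHamiltonianFlow Φ) {t : ℝ} (ht : t ∈ Icc (0 : ℝ) 1)
    {z : Cn n} (hz : z ≠ 0) :
    HasFDerivAt (Φ t) ((fderivWithin ℝ (fun p : ℝ × Cn n => Φ p.1 p.2) (Icc 0 1 ×ˢ {0}ᶜ)
      (t, z)).comp (ContinuousLinearMap.inr ℝ ℝ (Cn n))) z := by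
  have h1 := ((h.smooth.differentiableOn (by simp)) (t, z) ⟨ht, hz⟩).hasFDerivWithinAt
  have h2 := h1.comp z (hasFDerivAt_prodMk_right t z).hasFDerivWithinAt
    (s := {0}ᶜ) (fun y hy => ⟨ht, hy⟩)
  exact h2.hasFDerivAt (isOpen_compl_singleton.mem_nhds hz)

lemma fderiv_eq (h : IsEquivariantHamiltonianFlow Φ) {t : ℝ} (ht : t ∈ Icc (0 : ℝ) 1)
    {z : Cn n} (hz : z ≠ 0) :
    fderiv ℝ (Φ t) z = (fderivWithin ℝ (fun p : ℝ × Cn n => Φ p.1 p.2) (Icc 0 1 ×ˢ {0}ᶜ)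
      (t, z)).comp (ContinuousLinearMap.inr ℝ ℝ (Cn n)) := (h.hasFDerivAt ht hz).fderiv

lemma continuousOn_fderiv (h : IsEquivariantHamiltonianFlow Φ) {z : Cn n} (hz : z ≠ 0) :
    ContinuousOn (fun t => fderiv ℝ (Φ t) z) (Icc 0 1) := by
  have h1 := h.smooth.continuousOn_fderivWithin uniqueDiffOn_Icc_prod_compl (by simp)
  have h2 : ContinuousOn (fun t : ℝ => fderivWithin ℝ (fun p : ℝ × Cn n => Φ p.1 p.2)
      (Icc 0 1 ×ˢ {0}ᶜ) (t, z)) (Icc 0 1) :=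
    h1.comp (by fun_prop) fun t ht => ⟨ht, hz⟩
  exact (h2.clm_comp continuousOn_const).congr fun t ht => h.fderiv_eq ht hz

lemma fderiv_zero (h : IsEquivariantHamiltonianFlow Φ) (z : Cn n) : fderiv ℝ (Φ 0) z = 1 := by
  have : (Φ 0 : Cn n → Cn n) = id := funext h.map_zero
  rw [this]
  exact fderiv_id

/-- Equivariance along the curve `s ↦ (1 + sc)z`, differentiated at `0`. The scalar is complex
although the differential is only real linear. -/
lemma fderiv_smul_self (h : IsEquivariantHamiltonianFlow Φ) {t : ℝ} (ht : t ∈ Icc (0 : ℝ) 1)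
    {z : Cn n} (hz : z ≠ 0) (c : ℂ) : fderiv ℝ (Φ t) z (c • z) = c • Φ t z := by
  have h1 : HasDerivAt (fun s : ℝ => ((1 : ℂ) + s * c) • z) (c • z) 0 := by
    have := ((Complex.ofRealCLM.hasDerivAt (x := 0)).mul_const c).const_add 1
    simpa using this.smul_const z
  have h2 : HasDerivAt (fun s : ℝ => ((1 : ℂ) + s * c) • Φ t z) (c • Φ t z) 0 := by
    have := ((Complex.ofRealCLM.hasDerivAt (x := 0)).mul_const c).const_add 1
    simpa using this.smul_const (Φ t z)
  have h3 := HasFDerivAt.comp_hasDerivAt (0 : ℝ) (l := Φ t)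
    (by simpa using (h.hasFDerivAt ht hz).differentiableAt.hasFDerivAt) h1
  refine (h3.unique (h2.congr_of_eventuallyEq (.of_forall fun s => ?_)))
  exact h.equivariant t ht _ z

/-- The linearized Hamilton equation. -/
lemma exists_hasDerivAt_fderiv (h : IsEquivariantHamiltonianFlow Φ) {t : ℝ} (ht : t ∈ Ioo (0 : ℝ) 1)
    {z : Cn n} (hz : z ≠ 0) :
    ∃ K : Cn n →L[ℝ] Cn n →L[ℝ] ℝ, (∀ a b, K a b = K b a) ∧ ∀ v, ∃ y,
      HasDerivAt (fun s => fderiv ℝ (Φ s) z v) y t ∧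
        ∀ b, stdForm y b = K (fderiv ℝ (Φ t) z v) b := by
  obtain ⟨H, hH, hX⟩ := h.hamiltonian
  set f := fun p : ℝ × Cn n => Φ p.1 p.2
  have hopen : IsOpen (Ioo (0 : ℝ) 1 ×ˢ ({0}ᶜ : Set (Cn n))) :=
    isOpen_Ioo.prod isOpen_compl_singleton
  have hsub : Ioo (0 : ℝ) 1 ×ˢ ({0}ᶜ : Set (Cn n)) ⊆ Icc 0 1 ×ˢ {0}ᶜ :=
    prod_mono Ioo_subset_Icc_self le_rfl
  have hcd {p : ℝ × Cn n} (hp : p ∈ Ioo (0 : ℝ) 1 ×ˢ ({0}ᶜ : Set (Cn n))) :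
      ContDiffAt ℝ 2 f p :=
    ((h.smooth.mono hsub).contDiffAt (hopen.mem_nhds hp)).of_le ENat.LEInfty.out
  have hd {p : ℝ × Cn n} (hp : p ∈ Ioo (0 : ℝ) 1 ×ˢ ({0}ᶜ : Set (Cn n))) :
      HasFDerivAt f (fderiv ℝ f p) p :=
    ((hcd hp).differentiableAt (by simp)).hasFDerivAt
  have hslice {s : ℝ} (hs : s ∈ Ioo (0 : ℝ) 1) {y : Cn n} (hy : y ≠ 0) (v : Cn n) :
      fderiv ℝ (Φ s) y v = fderiv ℝ f (s, y) (0, v) := by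
    have := (hd (p := (s, y)) ⟨hs, hy⟩).comp y (hasFDerivAt_prodMk_right s y)
    rw [show Φ s = f ∘ (fun y => (s, y)) from rfl, this.fderiv]
    rfl
  have htime {s : ℝ} (hs : s ∈ Ioo (0 : ℝ) 1) {y : Cn n} (hy : y ≠ 0) (b : Cn n) :
      stdForm (fderiv ℝ f (s, y) (1, 0)) b = fderiv ℝ (H s) (Φ s y) b := by
    obtain ⟨X, hX1, hX2⟩ := hX s (Ioo_subset_Icc_self hs) y hy
    have h1 := HasFDerivAt.comp_hasDerivAt s (hd (p := (s, y)) ⟨hs, hy⟩)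
      ((hasDerivAt_id s).prodMk (hasDerivAt_const s y))
    have h2 : HasDerivAt (fun s => Φ s y) X s := hX1.hasDerivAt (Icc_mem_nhds hs.1 hs.2)
    rw [← hX2, ← h2.unique h1]
  have hp : (t, z) ∈ Ioo (0 : ℝ) 1 ×ˢ ({0}ᶜ : Set (Cn n)) := ⟨ht, hz⟩
  have hsymm : IsSymmSndFDerivAt ℝ f (t, z) := (hcd hp).isSymmSndFDerivAt (by simp)
  have hd2 : HasFDerivAt (fderiv ℝ f) (fderiv ℝ (fderiv ℝ f) (t, z)) (t, z) :=
    (((hcd hp).fderiv_right (m := 1) one_add_one_eq_two.le).differentiableAt (by simp)).hasFDerivAt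
  have hw : Φ t z ≠ 0 := h.map_ne_zero (Ioo_subset_Icc_self ht) hz
  have hHt : ContDiffAt ℝ 2 (H t) (Φ t z) := by
    have : ContDiffOn ℝ ∞ (fun y => H t y) ({0}ᶜ : Set (Cn n)) :=
      hH.comp (f := fun y => (t, y)) (by fun_prop) fun y hy => ⟨Ioo_subset_Icc_self ht, hy⟩
    exact (this.contDiffAt (isOpen_compl_singleton.mem_nhds hw)).of_le ENat.LEInfty.out
  have hHd : HasFDerivAt (fderiv ℝ (H t)) (fderiv ℝ (fderiv ℝ (H t)) (Φ t z)) (Φ t z) :=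
    ((hHt.fderiv_right (m := 1) one_add_one_eq_two.le).differentiableAt (by simp)).hasFDerivAt
  have hHs : IsSymmSndFDerivAt ℝ (H t) (Φ t z) := hHt.isSymmSndFDerivAt (by simp)
  refine ⟨fderiv ℝ (fderiv ℝ (H t)) (Φ t z), fun a b => hHs.eq a b, fun v =>
    ⟨fderiv ℝ (fderiv ℝ f) (t, z) (1, 0) (0, v), ?_, fun b => ?_⟩⟩
  · have h1 := HasFDerivAt.comp_hasDerivAt t hd2 ((hasDerivAt_id t).prodMk (hasDerivAt_const t z))
    have h2 : HasDerivAt (fun s => fderiv ℝ f (s, z) (0, v)) _ t :=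
      h1.clm_apply (hasDerivAt_const t ((0 : ℝ), v))
    rw [_root_.map_zero, add_zero] at h2
    refine h2.congr_of_eventuallyEq ?_
    filter_upwards [isOpen_Ioo.mem_nhds ht] with s hs
    exact hslice hs hz v
  -- Symmetry of second derivatives turns the time derivative of `dΦ_t v` into the derivative of
  -- Hamilton's equation in the direction `v`.
  · rw [hsymm.eq]
    have h1 : HasFDerivAt (fun y => fderiv ℝ f (t, y) (1, 0)) _ z :=
      ((hd2.comp z (hasFDerivAt_prodMk_right t z)).clm_apply
        (hasFDerivAt_const ((1 : ℝ), (0 : Cn n)) z))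
    have h2 := ((stdBilin n).flip b).toContinuousLinearMap.hasFDerivAt.comp z h1
    have h3 := (hHd.comp z (h.hasFDerivAt (Ioo_subset_Icc_self ht) hz).differentiableAt.hasFDerivAt
      ).clm_apply (hasFDerivAt_const b z)
    have h4 := h2.unique (h3.congr_of_eventuallyEq (by
      filter_upwards [isOpen_compl_singleton.mem_nhds hz] with y hy
      exact htime ht hy b))
    simpa using congrArg (fun L => L v) h4

/-- The derivative of `Ω(dΦ_s v, dΦ_s w)` vanishes because the Hessian of the Hamiltonian is
symmetric. The linearized equation holds at interior times, and the mean value theorem with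
continuity reaches the end points. -/
theorem isSymplecticMap_fderiv (h : IsEquivariantHamiltonianFlow Φ) {t : ℝ}
    (ht : t ∈ Icc (0 : ℝ) 1) {z : Cn n} (hz : z ≠ 0) : IsSymplecticMap (fderiv ℝ (Φ t) z) := by
  intro v w
  rcases ht.1.eq_or_lt with rfl | h0
  · rw [h.fderiv_zero]; rfl
  have hc : ContinuousOn (fun s => stdForm (fderiv ℝ (Φ s) z v) (fderiv ℝ (Φ s) z w))
      (Icc 0 t) := by
    have h1 := (h.continuousOn_fderiv hz).mono (Icc_subset_Icc_right ht.2)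
    exact continuous_stdForm.comp_continuousOn
      (f := fun s => (fderiv ℝ (Φ s) z v, fderiv ℝ (Φ s) z w)) ((h1.clm_apply continuousOn_const).prodMk (h1.clm_apply continuousOn_const))
  have hderiv : ∀ s ∈ Ioo 0 t, HasDerivAt
      (fun s => stdForm (fderiv ℝ (Φ s) z v) (fderiv ℝ (Φ s) z w)) 0 s := by
    intro s hs
    obtain ⟨K, hK, hy⟩ := h.exists_hasDerivAt_fderiv ⟨hs.1, hs.2.trans_le ht.2⟩ hz
    obtain ⟨y, hy1, hy2⟩ := hy v
    obtain ⟨y', hy1', hy2'⟩ := hy w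
    have h3 := Complex.imCLM.hasFDerivAt.comp_hasDerivAt s (hy1.inner ℂ hy1')
    have e : Complex.imCLM (inner ℂ (fderiv ℝ (Φ s) z v) y' + inner ℂ y (fderiv ℝ (Φ s) z w)) =
        0 := by
      rw [map_add]
      change stdForm _ _ + stdForm _ _ = 0
      rw [hy2, stdForm_comm, hy2', hK]
      ring
    rw [e] at h3
    exact h3
  obtain ⟨s, -, hs⟩ := exists_hasDerivAt_eq_slope _ (fun _ => 0) h0 hc hderiv
  rw [eq_comm, div_eq_zero_iff, sub_eq_zero] at hs
  rcases hs with hs | hs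
  · simp only [h.fderiv_zero] at hs
    exact hs
  · simp at hs; exact absurd hs h0.ne'

/-- Symplecticity tested on `cz`, whose image is `cΦ_t(z)`, gives the real part for `c = i` and the
imaginary part for `c = 1`. In particular, Hermitian complements are carried to Hermitian
complements. -/
lemma inner_fderiv (h : IsEquivariantHamiltonianFlow Φ) {t : ℝ}
    (ht : t ∈ Icc (0 : ℝ) 1) {z : Cn n} (hz : z ≠ 0) (v : Cn n) :
    inner ℂ (Φ t z) (fderiv ℝ (Φ t) z v) = inner ℂ z v := by
  have h1 (c : ℂ) := h.isSymplecticMap_fderiv ht hz (c • z) v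
  simp only [h.fderiv_smul_self ht hz] at h1
  apply Complex.ext
  · simpa [stdForm] using h1 Complex.I
  · simpa [stdForm] using h1 1

end IsEquivariantHamiltonianFlow

end Flow

/-! ### Horizontal lifts of tangent vectors of `ℂPᵈ` -/

section ProjectiveSpace

variable {d : ℕ}

/-- The differential of `π` at `Z`, in the preferred chart at `π(Z)`. -/
def quotDeriv (Z : Cn (d + 1)) : Cn (d + 1) →L[ℝ] Cn d :=
  fderiv ℝ (affineCoord (chartIndex (toCP Z))) Z

lemma hyperplaneIncl_injective (i : Fin (d + 1)) :
    Function.Injective (hyperplaneIncl i : Cn d → Cn (d + 1)) := fun a b h => by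
  ext j
  rw [← hyperplaneIncl_succAbove i a, h, hyperplaneIncl_succAbove]

/-- For `‖Z‖ = 1`, the inverse of the restriction of `quotDeriv Z` to the orthogonal complement of
`Z`. -/
def horizontalLift (Z : Cn (d + 1)) : Cn d →ₗ[ℝ] Cn (d + 1) where
  toFun a := Z (chartIndex (toCP Z)) • hyperplaneIncl (chartIndex (toCP Z)) a -
    inner ℂ Z (Z (chartIndex (toCP Z)) • hyperplaneIncl (chartIndex (toCP Z)) a) • Z
  map_add' a b := by
    have : hyperplaneIncl (chartIndex (toCP Z)) (a + b) =
        hyperplaneIncl (chartIndex (toCP Z)) a + hyperplaneIncl (chartIndex (toCP Z)) b := by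
      ext j
      rcases Fin.eq_self_or_eq_succAbove (chartIndex (toCP Z)) j with h | ⟨j, h⟩ <;> rw [h] <;> simp
    simp only [this, smul_add, inner_add_right, add_smul]
    abel
  map_smul' c a := by
    have : hyperplaneIncl (chartIndex (toCP Z)) (c • a) =
        (c : ℂ) • hyperplaneIncl (chartIndex (toCP Z)) a := by
      ext j
      rcases Fin.eq_self_or_eq_succAbove (chartIndex (toCP Z)) j with h | ⟨j, h⟩ <;> rw [h] <;> simp
    rw [this, smul_comm, inner_smul_right, mul_smul, ← smul_sub, Complex.coe_smul]
    rfl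

variable {Z : Cn (d + 1)}

lemma horizontalLift_apply (Z : Cn (d + 1)) (a : Cn d) : horizontalLift Z a =
    Z (chartIndex (toCP Z)) • hyperplaneIncl (chartIndex (toCP Z)) a -
      inner ℂ Z (Z (chartIndex (toCP Z)) • hyperplaneIncl (chartIndex (toCP Z)) a) • Z := rfl

lemma apply_chartIndex_ne_zero (hZ : Z ≠ 0) : Z (chartIndex (toCP Z)) ≠ 0 :=
  (toCP_mem_affineDomain hZ).1 (mem_affineDomain_chartIndex _)

lemma ne_zero_of_norm_eq_one (hZ : ‖Z‖ = 1) : Z ≠ 0 := by rintro rfl; simp at hZ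

lemma inner_self_of_norm_eq_one (hZ : ‖Z‖ = 1) : inner ℂ Z Z = 1 := by
  rw [inner_self_eq_norm_sq_to_K, hZ]; simp

/-- In the affine chart, `dπ(v)` is represented by `v / Zᵢ` modulo `ℂZ`; rescaling by `Zᵢ` and
projecting off `Z` leaves the horizontal part of `v`. -/
lemma horizontalLift_quotDeriv (hZ : ‖Z‖ = 1) (v : Cn (d + 1)) :
    horizontalLift Z (quotDeriv Z v) = v - inner ℂ Z v • Z := by
  have hi := apply_chartIndex_ne_zero (ne_zero_of_norm_eq_one hZ)
  have e : Z (chartIndex (toCP Z)) • hyperplaneIncl (chartIndex (toCP Z)) (quotDeriv Z v) =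
      v + (-(v (chartIndex (toCP Z))) / Z (chartIndex (toCP Z))) • Z := by
    rw [quotDeriv, hyperplaneIncl_fderiv_affineCoord _ hi, smul_add, smul_smul, smul_smul,
      mul_inv_cancel₀ hi, one_smul]
    congr 2
    field_simp
  rw [horizontalLift_apply, e, inner_add_right, inner_smul_right, inner_self_of_norm_eq_one hZ]
  module

lemma inner_horizontalLift (hZ : ‖Z‖ = 1) (a : Cn d) : inner ℂ Z (horizontalLift Z a) = 0 := by
  rw [horizontalLift_apply, inner_sub_right, inner_smul_right (y := Z),
    inner_self_of_norm_eq_one hZ, mul_one, sub_self]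

lemma quotDeriv_smul_self (hZ : Z ≠ 0) (c : ℂ) : quotDeriv Z (c • Z) = 0 := by
  have hi := apply_chartIndex_ne_zero hZ
  apply hyperplaneIncl_injective (chartIndex (toCP Z))
  rw [quotDeriv, hyperplaneIncl_fderiv_affineCoord _ hi, smul_smul, ← add_smul]
  have : (Z (chartIndex (toCP Z)))⁻¹ * c + -((c • Z) (chartIndex (toCP Z))) /
      Z (chartIndex (toCP Z)) ^ 2 = 0 := by
    rw [PiLp.smul_apply, smul_eq_mul]
    field_simp
    ring
  rw [this, zero_smul]
  ext j
  rcases Fin.eq_self_or_eq_succAbove (chartIndex (toCP Z)) j with h | ⟨j, h⟩ <;> rw [h] <;> simp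

lemma quotDeriv_horizontalLift (hZ : Z ≠ 0) (a : Cn d) : quotDeriv Z (horizontalLift Z a) = a := by
  have hi := apply_chartIndex_ne_zero hZ
  rw [horizontalLift_apply, map_sub, quotDeriv_smul_self hZ, sub_zero]
  apply hyperplaneIncl_injective (chartIndex (toCP Z))
  rw [quotDeriv, hyperplaneIncl_fderiv_affineCoord _ hi, smul_smul, inv_mul_cancel₀ hi]
  simp

lemma fubiniStudy_eq_stdForm_horizontalLift (hZ : ‖Z‖ = 1) (a b : Cn d) :
    fubiniStudy (toCP Z) a b = stdForm (horizontalLift Z a) (horizontalLift Z b) := by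
  have h0 := ne_zero_of_norm_eq_one hZ
  rw [← fubiniStudy_mfderiv_toCP hZ (by rw [inner_horizontalLift hZ]; rfl)
    (by rw [inner_horizontalLift hZ]; rfl), mfderiv_toCP h0]
  congr 1
  · exact (quotDeriv_horizontalLift h0 a).symm
  · exact (quotDeriv_horizontalLift h0 b).symm

lemma fubiniStudy_quotDeriv (hZ : ‖Z‖ = 1) {v w : Cn (d + 1)} (hv : inner ℂ Z v = 0)
    (hw : inner ℂ Z w = 0) : fubiniStudy (toCP Z) (quotDeriv Z v) (quotDeriv Z w) = stdForm v w := by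
  rw [fubiniStudy_eq_stdForm_horizontalLift hZ, horizontalLift_quotDeriv hZ,
    horizontalLift_quotDeriv hZ, hv, hw]
  simp

lemma contMDiffOn_toCP : ContMDiffOn 𝓘(ℝ, Cn (d + 1)) 𝓘(ℝ, Cn d) ∞ (toCP (d := d)) {0}ᶜ := by
  intro Z hZ
  apply ContMDiffAt.contMDiffWithinAt
  rw [contMDiffAt_iff]
  refine ⟨continuousAt_toCP hZ, ?_⟩
  have h := (contDiffAt_affineCoord (n := ∞) _ (apply_chartIndex_ne_zero hZ)).congr_of_eventuallyEq
    (f₁ := fun Y => affineCoord (chartIndex (toCP Z)) (toCP Y).rep) (by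
      filter_upwards [isOpen_ne.mem_nhds hZ] with Y hY
      exact affineCoord_rep_toCP _ hY)
  exact h.contDiffWithinAt

lemma hasMFDerivAt_toCP (hZ : Z ≠ 0) :
    HasMFDerivAt 𝓘(ℝ, Cn (d + 1)) 𝓘(ℝ, Cn d) toCP Z (quotDeriv Z) := by
  have h := (contMDiffOn_toCP.contMDiffAt (isOpen_compl_singleton.mem_nhds hZ)).mdifferentiableAt
    (by simp) |>.hasMFDerivAt
  rwa [mfderiv_toCP hZ] at h

/-- The `j`-th column of the orthogonal projection of `ℂᵈ⁺¹` onto the line spanned by `Z`. -/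
def lineProjColumn (j : Fin (d + 1)) (Z : Cn (d + 1)) : Cn (d + 1) :=
  ((starRingEnd ℂ (Z j)) / (‖Z‖ : ℂ) ^ 2) • Z

lemma lineProjColumn_smul (j : Fin (d + 1)) {c : ℂ} (hc : c ≠ 0) (Z : Cn (d + 1)) :
    lineProjColumn j (c • Z) = lineProjColumn j Z := by
  have hc' : (‖c‖ : ℂ) ≠ 0 := by simpa using hc
  have h : (starRingEnd ℂ) c * c = (‖c‖ : ℂ) ^ 2 := by
    rw [mul_comm, Complex.mul_conj, Complex.normSq_eq_norm_sq]; push_cast; rfl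
  rw [lineProjColumn, lineProjColumn, smul_smul, norm_smul, PiLp.smul_apply, smul_eq_mul, map_mul,
    Complex.ofReal_mul, mul_pow, ← h]
  congr 1
  have hc2 : (starRingEnd ℂ) c ≠ 0 := by simpa using hc
  rcases eq_or_ne Z 0 with rfl | hZ
  · simp
  have hZ' : (‖Z‖ : ℂ) ≠ 0 := by simpa using hZ
  field_simp

lemma contDiffAt_lineProjColumn (j : Fin (d + 1)) (hZ : Z ≠ 0) :
    ContDiffAt ℝ ∞ (lineProjColumn j) Z := by
  have h1 : ContDiffAt ℝ ∞ (fun Z : Cn (d + 1) => starRingEnd ℂ (Z j)) Z :=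
    Complex.conjCLE.contDiff.contDiffAt.comp Z (by fun_prop)
  have h2 : ContDiffAt ℝ ∞ (fun Z : Cn (d + 1) => ((‖Z‖ : ℂ) ^ 2)⁻¹) Z := by
    refine ContDiffAt.inv ?_ (by simpa using hZ)
    have : ContDiffAt ℝ ∞ (fun Z : Cn (d + 1) => ((‖Z‖ ^ 2 : ℝ) : ℂ)) Z :=
      Complex.ofRealCLM.contDiff.contDiffAt.comp Z (contDiff_norm_sq ℂ).contDiffAt
    simpa using this
  unfold lineProjColumn
  simp only [div_eq_mul_inv]
  exact (h1.mul h2).smul contDiffAt_id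

/-- The `j`-th column of the orthogonal projection of `ℂᵈ⁺¹` onto a complex line. -/
def projColumn (j : Fin (d + 1)) (p : CP d) : Cn (d + 1) := lineProjColumn j p.rep

lemma projColumn_toCP (j : Fin (d + 1)) (hZ : Z ≠ 0) :
    projColumn j (toCP Z) = lineProjColumn j Z := by
  obtain ⟨c, hc, h⟩ := exists_rep_toCP hZ
  rw [projColumn, h, lineProjColumn_smul j hc]

/-- The projector onto a line is a global smooth function, independent of the preferred charts,
whose index may jump from point to point. -/
lemma contMDiff_projColumn (j : Fin (d + 1)) :
    ContMDiff 𝓘(ℝ, Cn d) 𝓘(ℝ, Cn (d + 1)) ∞ (projColumn (d := d) j) := by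
  intro p
  rw [contMDiffAt_iff]
  refine ⟨?_, ?_⟩
  · apply Continuous.continuousAt
    rw [isQuotientMap_quotCP.continuous_iff]
    have : projColumn j ∘ quotCP = fun Z : {Z : Cn (d + 1) // Z ≠ 0} => lineProjColumn j Z.1 := by
      funext Z
      rw [Function.comp_apply, quotCP_eq, projColumn_toCP j Z.2]
    rw [this]
    exact continuous_iff_continuousAt.2 fun Z =>
      (contDiffAt_lineProjColumn j Z.2).continuousAt.comp continuousAt_subtype_val
  · have h (w : Cn d) : ContDiffAt ℝ ∞
        (fun w => projColumn j (toCP (affineIncl (chartIndex p) w))) w := by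
      simp only [projColumn_toCP j (affineIncl_ne_zero _ _)]
      exact (contDiffAt_lineProjColumn j (affineIncl_ne_zero _ _)).comp w
        (contDiff_affineIncl _).contDiffAt
    exact (h _).contDiffWithinAt

/-- Orthogonality gives `‖Z + sv‖² = 1 + s²‖v‖²`, so the denominator does not contribute to first
order. -/
lemma hasDerivAt_lineProjColumn (j : Fin (d + 1)) (hZ : ‖Z‖ = 1) {v : Cn (d + 1)}
    (hv : inner ℂ Z v = 0) : HasDerivAt (fun s : ℝ => lineProjColumn j (Z + s • v))
      (starRingEnd ℂ (v j) • Z + starRingEnd ℂ (Z j) • v) 0 := by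
  have hn (s : ℝ) : (‖Z + s • v‖ : ℂ) ^ 2 = ((1 + s ^ 2 * ‖v‖ ^ 2 : ℝ) : ℂ) := by
    have : inner ℂ Z (s • v) = 0 := by
      rw [← Complex.coe_smul, inner_smul_right, hv, mul_zero]
    have h2 := norm_add_sq_eq_norm_sq_add_norm_sq_of_inner_eq_zero Z (s • v) this
    rw [norm_smul, hZ, Real.norm_eq_abs] at h2
    rw [← Complex.ofReal_pow, Complex.ofReal_inj, sq, h2, mul_mul_mul_comm, abs_mul_abs_self]
    ring
  have h1 : HasDerivAt (fun s : ℝ => (1 + s ^ 2 * ‖v‖ ^ 2 : ℝ)) 0 0 := by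
    have := (((hasDerivAt_id (0 : ℝ)).pow 2).mul_const (‖v‖ ^ 2)).const_add 1
    simpa using this
  have h2 : HasDerivAt (fun s : ℝ => ((1 + s ^ 2 * ‖v‖ ^ 2 : ℝ) : ℂ)) 0 0 := by
    simpa using h1.ofReal_comp
  have h3 : HasDerivAt (fun s : ℝ => starRingEnd ℂ (Z j) + s * starRingEnd ℂ (v j))
      (starRingEnd ℂ (v j)) 0 := by
    simpa using ((Complex.ofRealCLM.hasDerivAt (x := 0)).mul_const
      (starRingEnd ℂ (v j))).const_add (starRingEnd ℂ (Z j))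
  have h4 : HasDerivAt (fun s : ℝ => Z + s • v) v 0 := by
    simpa using ((hasDerivAt_id (0 : ℝ)).smul_const v).const_add Z
  have h5 := (h3.fun_div h2 (by simp)).smul h4
  have h6 : HasDerivAt (fun s : ℝ => lineProjColumn j (Z + s • v)) _ 0 :=
    h5.congr_of_eventuallyEq (.of_forall fun s => by
      simp only [lineProjColumn, hn]
      simp)
  convert! h6 using 1
  simp
  abel

/-- The differential of `projColumn j`. -/
def projColumnDeriv (j : Fin (d + 1)) (p : CP d) : Cn d →L[ℝ] Cn (d + 1) :=
  mfderiv 𝓘(ℝ, Cn d) 𝓘(ℝ, Cn (d + 1)) (projColumn j) p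

/-- The horizontal lift of tangent vectors of `ℂPᵈ` is given by the differentials of smooth
functions on `ℂPᵈ`. -/
lemma sum_smul_mfderiv_projColumn (hZ : ‖Z‖ = 1) (a : Cn d) :
    ∑ j, Z j • projColumnDeriv j (toCP Z) a = horizontalLift Z a := by
  have h0 := ne_zero_of_norm_eq_one hZ
  set v := horizontalLift Z a with hv
  have hZv := inner_horizontalLift hZ a
  rw [← hv] at hZv
  have key (j : Fin (d + 1)) : projColumnDeriv j (toCP Z) a =
      starRingEnd ℂ (v j) • Z + starRingEnd ℂ (Z j) • v := by
    have h1 := ((contMDiff_projColumn j).mdifferentiable (by simp) (toCP Z)).hasMFDerivAt.comp Z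
      (hasMFDerivAt_toCP h0)
    have h2 : HasFDerivAt (lineProjColumn j)
        ((projColumnDeriv j (toCP Z)).comp (quotDeriv Z)) Z := by
      have h3 : HasFDerivAt (projColumn j ∘ toCP) ((projColumnDeriv j (toCP Z)).comp (quotDeriv Z))
        Z := hasMFDerivAt_iff_hasFDerivAt.1 h1
      refine h3.congr_of_eventuallyEq ?_
      filter_upwards [isOpen_ne.mem_nhds h0] with Y hY
      exact (projColumn_toCP j hY).symm
    have h4 : HasDerivAt (fun s : ℝ => Z + s • v) v 0 := by
      simpa using ((hasDerivAt_id (0 : ℝ)).smul_const v).const_add Z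
    have h5 := HasFDerivAt.comp_hasDerivAt (0 : ℝ) (l := lineProjColumn j)
      (by simpa using h2) h4
    rw [← h5.unique (hasDerivAt_lineProjColumn j hZ hZv)]
    exact congrArg (projColumnDeriv j (toCP Z)) (quotDeriv_horizontalLift h0 a).symm
  -- The projector `ZZ*` has derivative `vZ* + Zv*` in the direction `v`. Applied to `Z` this is
  -- `v`, because `v` is orthogonal to the unit vector `Z`.
  simp only [key, smul_add, smul_smul, Finset.sum_add_distrib, ← Finset.sum_smul]
  have e1 : ∑ j, Z j * starRingEnd ℂ (v j) = 0 := by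
    rw [← inner_conj_symm] at hZv
    have := (map_eq_zero _).1 hZv
    rw [PiLp.inner_apply] at this
    simpa using this
  have e2 : ∑ j, Z j * starRingEnd ℂ (Z j) = 1 := by
    have := inner_self_of_norm_eq_one hZ
    rw [PiLp.inner_apply] at this
    simpa only [RCLike.inner_apply] using this
  rw [e1, e2, zero_smul, zero_add, one_smul]

end ProjectiveSpace

/-! ### Frames of complements and symplectic trivializations over the disk -/

section Trivialization

variable {d : ℕ}

/-- The formula for the lift involves the chart index, which need not be continuous; the tangent
maps of the projector columns express it continuously. -/
lemma continuousOn_horizontalLift {X : Type*} [TopologicalSpace X] {s : Set X}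
    {V : X → Cn (d + 1)} (hV : ContinuousOn V s) (hV1 : ∀ x ∈ s, ‖V x‖ = 1) {f : X → Cn d}
    (hf : ContinuousOn (fun x => (⟨toCP (V x), f x⟩ : TangentBundle 𝓘(ℝ, Cn d) (CP d))) s) :
    ContinuousOn (fun x => horizontalLift (V x) (f x)) s := by
  have h (j : Fin (d + 1)) : ContinuousOn (fun x => projColumnDeriv j (toCP (V x)) (f x)) s := by
    have h1 := ((contMDiff_projColumn j).continuous_tangentMap (by simp)).comp_continuousOn hf
    have h2 := (tangentBundleModelSpaceHomeomorph 𝓘(ℝ, Cn (d + 1))).continuous.comp_continuousOn h1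
    exact continuous_snd.comp_continuousOn h2
  refine ContinuousOn.congr (f := fun x => ∑ j, V x j • projColumnDeriv j (toCP (V x)) (f x)) ?_
    fun x hx => (sum_smul_mfderiv_projColumn (hV1 x hx) (f x)).symm
  refine continuousOn_finsetSum _ fun j _ => ?_
  have h1 : ContinuousOn (fun x => V x j) s :=
    (EuclideanSpace.proj (𝕜 := ℂ) j).continuous.comp_continuousOn hV
  exact h1.fun_smul (h j)

lemma continuousOn_quotDeriv {X : Type*} [TopologicalSpace X] {s : Set X}
    {V : X → Cn (d + 1)} (hV : ContinuousOn V s) (hV1 : ∀ x ∈ s, V x ≠ 0) {f : X → Cn (d + 1)}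
    (hf : ContinuousOn f s) :
    ContinuousOn (fun x => (⟨toCP (V x), quotDeriv (V x) (f x)⟩ :
      TangentBundle 𝓘(ℝ, Cn d) (CP d))) s := by
  have h1 := (contMDiffOn_toCP (d := d)).continuousOn_tangentMapWithin (by simp)
    isOpen_compl_singleton.uniqueMDiffOn
  have h2 : ContinuousOn (fun x => (⟨V x, f x⟩ : TangentBundle 𝓘(ℝ, Cn (d + 1)) (Cn (d + 1)))) s :=
    (tangentBundleModelSpaceHomeomorph 𝓘(ℝ, Cn (d + 1))).symm.continuous.comp_continuousOn
      (hV.prodMk hf)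
  refine (h1.comp h2 fun x hx => hV1 x hx).congr fun x hx => ?_
  have e : mfderivWithin 𝓘(ℝ, Cn (d + 1)) 𝓘(ℝ, Cn d) toCP {0}ᶜ (V x) = quotDeriv (V x) := by
    rw [mfderivWithin_of_isOpen isOpen_compl_singleton (hV1 x hx), mfderiv_toCP (hV1 x hx)]
    rfl
  simp only [Function.comp_apply, tangentMapWithin]
  rw [e]
  rfl

/-- A linear map sending the orthogonal complement of the unit vector `v` isometrically to the
orthogonal complement of the unit vector `v'`. -/
def complementTransport (v v' x : Cn (d + 1)) : Cn (d + 1) :=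
  x - (inner ℂ v' x / (1 + inner ℂ v' v)) • (v + v')

lemma complementTransport_add (v v' x y : Cn (d + 1)) : complementTransport v v' (x + y) =
    complementTransport v v' x + complementTransport v v' y := by
  simp only [complementTransport, inner_add_right, add_div, add_smul]
  abel

lemma complementTransport_smul (v v' : Cn (d + 1)) (c : ℝ) (x : Cn (d + 1)) :
    complementTransport v v' (c • x) = c • complementTransport v v' x := by
  rw [← Complex.coe_smul, ← Complex.coe_smul]
  simp only [complementTransport, inner_smul_right, mul_div_assoc, smul_sub, smul_smul]

lemma inner_complementTransport {v v' : Cn (d + 1)} (hv' : ‖v'‖ = 1)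
    (h : 1 + inner ℂ v' v ≠ (0 : ℂ)) (x : Cn (d + 1)) :
    inner ℂ v' (complementTransport v v' x) = 0 := by
  rw [complementTransport, inner_sub_right, inner_smul_right _ (v + v'), inner_add_right,
    inner_self_of_norm_eq_one hv', add_comm (inner ℂ v' v) 1, div_mul_cancel₀ _ h, sub_self]

lemma inner_complementTransport_complementTransport {v v' : Cn (d + 1)} (hv : ‖v‖ = 1)
    (hv' : ‖v'‖ = 1) (h : 1 + inner ℂ v' v ≠ (0 : ℂ)) {x y : Cn (d + 1)} (hx : inner ℂ v x = 0)
    (hy : inner ℂ v y = 0) :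
    inner ℂ (complementTransport v v' x) (complementTransport v v' y) = inner ℂ x y := by
  have hx' : inner ℂ x v = 0 := by rw [← inner_conj_symm, hx, map_zero]
  have h1 : (starRingEnd ℂ) (1 + inner ℂ v' v) = 1 + inner ℂ v v' := by simp
  have h2 : 1 + inner ℂ v v' ≠ (0 : ℂ) := fun h3 => h (by
    rw [← h1] at h3
    exact (map_eq_zero _).1 h3)
  simp only [complementTransport, inner_sub_left, inner_sub_right, inner_add_left, inner_add_right,
    inner_smul_left, inner_smul_right, inner_self_of_norm_eq_one hv, inner_self_of_norm_eq_one hv',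
    hx', hy, map_div₀, h1, inner_conj_symm]
  field_simp
  ring

/-- An inner product equal to `-1` would put the two unit vectors at distance `2`. -/
lemma one_add_inner_ne_zero {v v' : Cn (d + 1)} (hv : ‖v‖ = 1) (hv' : ‖v'‖ = 1)
    (h : ‖v' - v‖ < 1) : 1 + inner ℂ v' v ≠ (0 : ℂ) := by
  intro h0
  have h1 := norm_sub_sq (𝕜 := ℂ) v' v
  rw [hv, hv', eq_neg_of_add_eq_zero_right h0] at h1
  simp at h1
  nlinarith [norm_nonneg (v' - v)]

/-- A continuous family of unit vectors over the disk has a continuous family of orthonormal frames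
of the orthogonal complements. -/
lemma exists_complement_frame {U : ℂ → Cn (d + 1)} (hU : ContinuousOn U (Metric.closedBall 0 1))
    (hU1 : ∀ w ∈ Metric.closedBall (0 : ℂ) 1, ‖U w‖ = 1) :
    ∃ ι : ℂ → Cn d →ₗ[ℝ] Cn (d + 1),
      ContinuousOn (fun p : ℂ × Cn d => ι p.1 p.2) (Metric.closedBall 0 1 ×ˢ univ) ∧
      ∀ w ∈ Metric.closedBall (0 : ℂ) 1, (∀ a, inner ℂ (U w) (ι w a) = 0) ∧
        ∀ a b, inner ℂ (ι w a) (ι w b) = inner ℂ a b := by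
  obtain ⟨δ, hδ, hUδ⟩ := Metric.uniformContinuousOn_iff.1
    ((isCompact_closedBall (0 : ℂ) 1).uniformContinuousOn_of_continuous hU) 1 one_pos
  obtain ⟨N, hN⟩ := exists_nat_one_div_lt hδ
  let r (j : ℕ) : ℝ := j / ((N : ℝ) + 1)
  have hr {j : ℕ} (hj : j ≤ N + 1) : r j ∈ Icc (0 : ℝ) 1 := by
    refine ⟨by positivity, (div_le_one (by positivity)).2 (by exact_mod_cast hj)⟩
  have hmem {j : ℕ} (hj : j ≤ N + 1) {w : ℂ} (hw : w ∈ Metric.closedBall (0 : ℂ) 1) :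
      r j • w ∈ Metric.closedBall (0 : ℂ) 1 := by
    rw [mem_closedBall_zero_iff] at hw ⊢
    rw [norm_smul, Real.norm_of_nonneg (hr hj).1]
    exact mul_le_one₀ (hr hj).2 (norm_nonneg _) hw
  have hUc {j : ℕ} (hj : j ≤ N + 1) : ContinuousOn (fun p : ℂ × Cn d => U (r j • p.1))
      (Metric.closedBall 0 1 ×ˢ univ) :=
    hU.comp (by fun_prop) fun p hp => hmem hj hp.1
  have hclose {j : ℕ} (hj : j + 1 ≤ N + 1) {w : ℂ} (hw : w ∈ Metric.closedBall (0 : ℂ) 1) :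
      1 + inner ℂ (U (r (j + 1) • w)) (U (r j • w)) ≠ (0 : ℂ) := by
    refine one_add_inner_ne_zero (hU1 _ (hmem (by omega) hw)) (hU1 _ (hmem hj hw)) ?_
    rw [← dist_eq_norm]
    refine hUδ _ (hmem hj hw) _ (hmem (by omega) hw) (lt_of_le_of_lt ?_ hN)
    rw [dist_eq_norm, ← sub_smul, norm_smul]
    have : r (j + 1) - r j = 1 / ((N : ℝ) + 1) := by
      simp only [r]; push_cast; ring
    rw [this, Real.norm_of_nonneg (by positivity)]
    rw [mem_closedBall_zero_iff] at hw
    exact mul_le_of_le_one_right (by positivity) hw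
  -- An orthonormal basis of the complement of `U 0`, constant in `w`, is transported outwards along
  -- each radius, from `U (r j • w)` to `U (r (j + 1) • w)`.
  have key (j : ℕ) (hj : j ≤ N + 1) : ∃ ι : ℂ → Cn d →ₗ[ℝ] Cn (d + 1),
      ContinuousOn (fun p : ℂ × Cn d => ι p.1 p.2) (Metric.closedBall 0 1 ×ˢ univ) ∧
      ∀ w ∈ Metric.closedBall (0 : ℂ) 1, (∀ a, inner ℂ (U (r j • w)) (ι w a) = 0) ∧
        ∀ a b, inner ℂ (ι w a) (ι w b) = inner ℂ a b := by
    induction j with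
    | zero =>
      have h0 : U 0 ≠ 0 := ne_zero_of_norm_eq_one (hU1 0 (by simp))
      have : Fact (Module.finrank ℂ (Cn (d + 1)) = d + 1) := ⟨by simp⟩
      let e := (OrthonormalBasis.fromOrthogonalSpanSingleton (𝕜 := ℂ) d h0).repr.symm
      refine ⟨fun _ => ((Submodule.subtype _).comp
        e.toLinearEquiv.toLinearMap).restrictScalars ℝ, ?_, fun w _ => ⟨fun a => ?_, fun a b => ?_⟩⟩
      · exact (continuous_subtype_val.comp (e.continuous.comp continuous_snd)).continuousOn
      · have hr0 : r 0 = 0 := by simp [r]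
        rw [hr0, zero_smul]
        exact Submodule.mem_orthogonal_singleton_iff_inner_right.1 (e a).2
      · exact e.inner_map_map a b
    | succ j ih =>
      obtain ⟨ι, hc, hι⟩ := ih (by omega)
      refine ⟨fun w =>
        { toFun := fun a => complementTransport (U (r j • w)) (U (r (j + 1) • w)) (ι w a)
          map_add' := fun a b => by rw [map_add, complementTransport_add]
          map_smul' := fun c a => by
            rw [map_smul, complementTransport_smul, RingHom.id_apply] }, ?_, fun w hw =>
        ⟨fun a => ?_, fun a b => ?_⟩⟩
      · have h1 := hUc (j := j) (by omega)
        have h2 := hUc hj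
        simp only [LinearMap.coe_mk, AddHom.coe_mk, complementTransport]
        exact hc.sub (((h2.inner hc).div (continuousOn_const.add (h2.inner h1))
          fun p hp => hclose hj hp.1).smul (h1.add h2))
      · exact inner_complementTransport (hU1 _ (hmem hj hw)) (hclose hj hw) _
      · refine (inner_complementTransport_complementTransport (hU1 _ (hmem (by omega) hw))
          (hU1 _ (hmem hj hw)) (hclose hj hw) ((hι w hw).1 a) ((hι w hw).1 b)).trans ?_
        exact (hι w hw).2 a b
  obtain ⟨ι, hc, hι⟩ := key (N + 1) le_rfl
  have h1 : r (N + 1) = 1 := by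
    simp [r, div_self (by positivity : (N : ℝ) + 1 ≠ 0)]
  simp only [h1, one_smul] at hι
  exact ⟨ι, hc, hι⟩

/-- On the complement of `U w`, `dπ` is injective and symplectic, so it turns a unitary frame into a
symplectic one. -/
theorem exists_isSymplecticTrivialization {U : ℂ → Cn (d + 1)}
    (hU : ContinuousOn U (Metric.closedBall 0 1))
    (hU1 : ∀ w ∈ Metric.closedBall (0 : ℂ) 1, ‖U w‖ = 1) :
    ∃ ξ, IsSymplecticTrivialization fubiniStudy (toCP ∘ U) ξ := by
  classical
  obtain ⟨ι, hc, hι⟩ := exists_complement_frame hU hU1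
  have hinj (w) (hw : w ∈ Metric.closedBall (0 : ℂ) 1) :
      Function.Injective ((quotDeriv (U w)).toLinearMap.comp (ι w)) := by
    rw [← LinearMap.ker_eq_bot, LinearMap.ker_eq_bot']
    intro a ha
    have h1 := horizontalLift_quotDeriv (hU1 w hw) (ι w a)
    rw [show quotDeriv (U w) (ι w a) = 0 from ha, map_zero, (hι w hw).1, zero_smul, sub_zero] at h1
    have h2 := (hι w hw).2 a a
    rw [← h1, inner_zero_left] at h2
    exact inner_self_eq_zero.1 h2.symm
  -- The identity is a filler off the disk, where nothing is required of `ξ`.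
  let ξ (w : ℂ) : Cn d ≃L[ℝ] Cn d :=
    if hw : w ∈ Metric.closedBall (0 : ℂ) 1 then
      (LinearEquiv.ofInjectiveEndo _ (hinj w hw)).toContinuousLinearEquiv
    else ContinuousLinearEquiv.refl ℝ _
  have hξ (w) (hw : w ∈ Metric.closedBall (0 : ℂ) 1) (a) : ξ w a = quotDeriv (U w) (ι w a) := by
    simp only [ξ, dif_pos hw]
    rfl
  refine ⟨ξ, ?_, fun w hw a b => ?_⟩
  · refine (continuousOn_quotDeriv (hU.comp continuousOn_fst fun p hp => hp.1)
      (fun p hp => ne_zero_of_norm_eq_one (hU1 _ hp.1)) hc).congr fun p hp => ?_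
    exact congrArg (fun a => (⟨toCP (U p.1), a⟩ : TangentBundle 𝓘(ℝ, Cn d) (CP d)))
      (hξ p.1 hp.1 p.2)
  · have h := fubiniStudy_quotDeriv (hU1 w hw) ((hι w hw).1 a) ((hι w hw).1 b)
    rw [← hξ w hw, ← hξ w hw] at h
    refine h.trans ?_
    rw [stdForm, (hι w hw).2, stdForm]

end Trivialization

/-! ### The homotopy between the lifted and the trivialized paths -/

section Comparison

variable {d : ℕ}

lemma circlePoint_zero : circlePoint 0 = 1 := by simp [circlePoint]

lemma circlePoint_one : circlePoint 1 = 1 := by simp [circlePoint]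

lemma norm_circlePoint (t : ℝ) : ‖circlePoint t‖ = 1 := by
  rw [circlePoint, ← Complex.norm_exp_ofReal_mul_I (2 * Real.pi * t)]
  push_cast
  rfl

lemma continuous_circlePoint : Continuous circlePoint := by
  unfold circlePoint
  fun_prop

lemma smul_circlePoint_mem (s : unitInterval) (t : ℝ) :
    (s : ℝ) • circlePoint t ∈ Metric.closedBall (0 : ℂ) 1 := by
  rw [mem_closedBall_zero_iff, norm_smul, norm_circlePoint, mul_one, Real.norm_of_nonneg s.2.1]
  exact s.2.2

lemma inverse_apply_of_apply_eq {n : ℕ} {A : Cn n →L[ℝ] Cn n} (hA : IsUnit A) {v w : Cn n}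
    (h : A v = w) : Ring.inverse A w = v := by
  rw [← h, ← mul_apply_eq_comp, Ring.inverse_mul_cancel _ hA]
  rfl

lemma stdForm_add_smul_add_smul {n : ℕ} {Z v w : Cn n} (hZ : inner ℂ Z Z = (1 : ℂ))
    (hv : inner ℂ Z v = 0) (hw : inner ℂ Z w = 0) (α β : ℂ) :
    stdForm (v + α • Z) (w + β • Z) = stdForm v w + (starRingEnd ℂ α * β).im := by
  have hv' : inner ℂ v Z = 0 := by rw [← inner_conj_symm, hv, map_zero]
  simp only [stdForm, inner_add_left, inner_add_right, inner_smul_left, inner_smul_right, hZ, hv',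
    hw, mul_zero, zero_add, add_zero, mul_one, Complex.add_im]
  rw [mul_comm β]

/-- The extension to `ℂᵈ⁺¹ = ι₁(ℂᵈ) ⊕ ℂ Z₀` of a symplectic map `ι` by `Z₀ ↦ Z`. -/
def frameExtension (ι : Cn d →ₗ[ℝ] Cn (d + 1)) (ρ : Cn (d + 1) →L[ℝ] Cn d)
    (Z₀ Z : Cn (d + 1)) : Cn (d + 1) →L[ℝ] Cn (d + 1) :=
  LinearMap.toContinuousLinearMap ι ∘L ρ +
    ((innerSL ℂ Z₀).smulRight Z).restrictScalars ℝ

/-- If the differentials of the flow along the orbit of `Z₀` are conjugate, through frames of the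
complements of `U` over the disk, to a path `γ` on `ℂᵈ`, then they have the Maslov index of `γ`. -/
theorem hasMaslovIndex_of_complement_frame {Φ : ℝ → (Cn (d + 1) ≃ₜ Cn (d + 1))}
    (hΦ : IsEquivariantHamiltonianFlow Φ) {Z₀ : Cn (d + 1)} (hZ₀ : ‖Z₀‖ = 1)
    {U : ℂ → Cn (d + 1)} (hU : IsCapping (fun t => Φ t Z₀) U)
    (hU1 : ∀ w ∈ Metric.closedBall (0 : ℂ) 1, ‖U w‖ = 1) {ι : ℂ → Cn d →ₗ[ℝ] Cn (d + 1)}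
    (hιc : ContinuousOn (fun p : ℂ × Cn d => ι p.1 p.2) (Metric.closedBall 0 1 ×ˢ univ))
    (hιU : ∀ w ∈ Metric.closedBall (0 : ℂ) 1, ∀ a, inner ℂ (U w) (ι w a) = 0)
    (hιs : ∀ w ∈ Metric.closedBall (0 : ℂ) 1, ∀ a b, stdForm (ι w a) (ι w b) = stdForm a b)
    {ρ : Cn (d + 1) →L[ℝ] Cn d} (hρι : ∀ a, ρ (ι 1 a) = a) (hρZ : ∀ c : ℂ, ρ (c • Z₀) = 0)
    (hιρ : ∀ v, ι 1 (ρ v) + inner ℂ Z₀ v • Z₀ = v) {γ : ℝ → (Cn d →L[ℝ] Cn d)}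
    (hγ : ∀ t ∈ Icc (0 : ℝ) 1, ∀ a, ι (circlePoint t) (γ t a) = fderiv ℝ (Φ t) Z₀ (ι 1 a))
    {m : ℤ} (hm : HasMaslovIndex (fun t => fderiv ℝ (Φ t) Z₀) m) : HasMaslovIndex γ m := by
  have hZ0 : Z₀ ≠ 0 := ne_zero_of_norm_eq_one hZ₀
  have h1mem : (1 : ℂ) ∈ Metric.closedBall (0 : ℂ) 1 := by simp
  have hU1eq : U 1 = Z₀ := by
    rw [← circlePoint_zero, hU.boundary 0 (by simp)]
    exact hΦ.map_zero Z₀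
  have hcmem (t : ℝ) : circlePoint t ∈ Metric.closedBall (0 : ℂ) 1 := by
    rw [mem_closedBall_zero_iff, norm_circlePoint]
  set M : ℂ → (Cn (d + 1) →L[ℝ] Cn (d + 1)) := fun w => frameExtension (ι w) ρ Z₀ (U w)
  have hMapp (w v) : M w v = ι w (ρ v) + inner ℂ Z₀ v • U w := rfl
  have hMc : ContinuousOn M (Metric.closedBall 0 1) := by
    rw [continuousOn_clm_apply]
    intro v
    simp only [hMapp]
    exact (hιc.comp (f := fun w => (w, ρ v)) (by fun_prop) fun w hw => ⟨hw, mem_univ _⟩).add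
      (continuousOn_const.fun_smul hU.continuousOn)
  have hM1 : M 1 = 1 := by
    ext1 v
    rw [hMapp, hU1eq, hιρ]
    rfl
  have hMs (w) (hw : w ∈ Metric.closedBall (0 : ℂ) 1) : IsSymplecticMap (M w) := fun v v' => by
    rw [hMapp, hMapp, stdForm_add_smul_add_smul (inner_self_of_norm_eq_one (hU1 w hw)) (hιU w hw _)
      (hιU w hw _), hιs w hw]
    conv_rhs => rw [← hιρ v, ← hιρ v']
    rw [stdForm_add_smul_add_smul (inner_self_of_norm_eq_one hZ₀) (hU1eq ▸ hιU 1 h1mem _)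
      (hU1eq ▸ hιU 1 h1mem _), hιs 1 h1mem]
  have hMι (w a) : M w (ι 1 a) = ι w a := by
    rw [hMapp, hρι, ← hU1eq, hιU 1 h1mem, zero_smul, add_zero]
  have hMZ (w) (c : ℂ) : M w (c • Z₀) = c • U w := by
    rw [hMapp, hρZ, map_zero, zero_add, inner_smul_right, inner_self_of_norm_eq_one hZ₀, mul_one]
  set Γ : ℝ → (Cn (d + 1) →L[ℝ] Cn (d + 1)) :=
    fun t => Ring.inverse (M (circlePoint t)) * fderiv ℝ (Φ t) Z₀ with hΓ
  have hΓapp (t v) : Γ t v = Ring.inverse (M (circlePoint t)) (fderiv ℝ (Φ t) Z₀ v) := rfl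
  have hΓι (t) (ht : t ∈ Icc (0 : ℝ) 1) (a) : Γ t (ι 1 a) = ι 1 (γ t a) := by
    rw [hΓapp]
    exact inverse_apply_of_apply_eq (hMs _ (hcmem t)).isUnit (by rw [hMι, hγ t ht])
  have hΓρ (t) (ht : t ∈ Icc (0 : ℝ) 1) (v) (hv : ρ v = 0) : Γ t v = v := by
    rw [hΓapp]
    refine inverse_apply_of_apply_eq (hMs _ (hcmem t)).isUnit ?_
    have e := hιρ v
    rw [hv, map_zero, zero_add] at e
    rw [← e, hMZ, hΦ.fderiv_smul_self ht hZ0, hU.boundary t ht]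
  -- The left factor `M(s)` fixes the ends: the circle point is `1` at `t = 0` and `t = 1`, so the
  -- two frame factors cancel. At `s = 0` they cancel for all `t`, leaving `dΦ_t(Z₀)`; at `s = 1`
  -- the left factor is `M(1) = 1`, leaving `Γ_t`.
  let H : unitInterval × unitInterval → (Cn (d + 1) →L[ℝ] Cn (d + 1)) := fun p =>
    M (p.1 : ℝ) * (Ring.inverse (M ((p.1 : ℝ) • circlePoint p.2)) * fderiv ℝ (Φ p.2) Z₀)
  have hsmem (s : unitInterval) : ((s : ℝ) : ℂ) ∈ Metric.closedBall (0 : ℂ) 1 := by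
    simpa [circlePoint_zero] using smul_circlePoint_mem s 0
  have hHs (p) : IsSymplecticMap (H p) :=
    (hMs _ (hsmem p.1)).mul ((hMs _ (smul_circlePoint_mem p.1 p.2)).inverse.mul
      (hΦ.isSymplecticMap_fderiv p.2.2 hZ0))
  have hHc : Continuous H := by
    have c1 : Continuous fun p : unitInterval × unitInterval => M (p.1 : ℝ) :=
      hMc.comp_continuous (by fun_prop) fun p => hsmem p.1
    have c2 : Continuous fun p : unitInterval × unitInterval => M ((p.1 : ℝ) • circlePoint p.2) :=
      hMc.comp_continuous (continuous_subtype_val.comp continuous_fst |>.smul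
        (continuous_circlePoint.comp (continuous_subtype_val.comp continuous_snd)))
        fun p => smul_circlePoint_mem p.1 p.2
    have c3 : Continuous fun p : unitInterval × unitInterval => fderiv ℝ (Φ p.2) Z₀ :=
      (hΦ.continuousOn_fderiv hZ0).comp_continuous (by fun_prop) fun p => p.2.2
    exact c1.mul ((continuous_inverse_of_isUnit c2
      fun p => (hMs _ (smul_circlePoint_mem p.1 p.2)).isUnit).mul c3)
  have hΓm : HasMaslovIndex Γ m := by
    refine hm.of_homotopy hHc hHs (fun s => ?_) (fun s => ?_) (fun t => ?_) fun t => ?_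
    · simp only [H, Icc.coe_zero, circlePoint_zero, hΦ.fderiv_zero, mul_one, Complex.real_smul]
      exact Ring.mul_inverse_cancel _ (hMs _ (hsmem s)).isUnit
    · simp only [H, Icc.coe_one, circlePoint_one, Complex.real_smul, mul_one]
      exact Ring.mul_inverse_cancel_left _ _ (hMs _ (hsmem s)).isUnit
    · simp only [H, Icc.coe_zero, zero_smul, Complex.ofReal_zero]
      exact (Ring.mul_inverse_cancel_left _ _ (hMs _ (by simp)).isUnit).symm
    · simp only [H, Icc.coe_one, one_smul, Complex.ofReal_one, hM1, one_mul, hΓ]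
  let ι₁ : Cn d →L[ℝ] Cn (d + 1) := LinearMap.toContinuousLinearMap (ι 1)
  have hγ' (t) (ht : t ∈ Icc (0 : ℝ) 1) : γ t = ρ ∘L Γ t ∘L ι₁ := by
    ext1 a
    exact ((congrArg ρ (hΓι t ht a)).trans (hρι _)).symm
  -- The frame at `1` pairs only with the horizontal part of `v`, since the complement and `ℂZ₀` are
  -- orthogonal for `Ω`.
  have hι₁ (a v) : stdForm (ι 1 a) v = stdForm a (ρ v) := by
    conv_lhs => rw [← hιρ v, ← add_zero (ι 1 a), ← zero_smul ℂ Z₀]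
    rw [stdForm_add_smul_add_smul (inner_self_of_norm_eq_one hZ₀) (hU1eq ▸ hιU 1 h1mem _)
      (hU1eq ▸ hιU 1 h1mem _), hιs 1 h1mem]
    simp
  refine hΓm.of_stabilization (ι := ι₁) (ρ := ρ) ?_ (fun t ht a b => ?_) ?_ hρι hι₁
    (fun t ht a => hΓι t ht a) hΓρ
  · exact (continuousOn_const.clm_comp (hΓm.continuousOn.clm_comp continuousOn_const)).congr hγ'
  · rw [← hιs 1 h1mem, ← hΓι t ht, ← hΓι t ht, hΓm.symplectic t ht, hιs 1 h1mem]
  · ext1 a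
    have e : γ 0 a = ρ (Γ 0 (ι 1 a)) := by rw [hγ' 0 (by simp)]; rfl
    have e2 : Γ 0 = 1 := by
      simp only [hΓ, circlePoint_zero, hM1, hΦ.fderiv_zero, Ring.inverse_one, mul_one]
    rw [e, e2]
    exact hρι a

variable {Φ : ℝ → (Cn (d + 1) ≃ₜ Cn (d + 1))} {φ : ℝ → (CP d ≃ₜ CP d)}

lemma toCP_flow_of_lift (hΦ : IsEquivariantHamiltonianFlow Φ) {t : ℝ} (ht : t ∈ Icc (0 : ℝ) 1)
    (hlift : ∀ Z : Cn (d + 1), ‖Z‖ = 1 → toCP (Φ t Z) = φ t (toCP Z)) {Z : Cn (d + 1)}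
    (hZ : Z ≠ 0) : toCP (Φ t Z) = φ t (toCP Z) := by
  have hn : (‖Z‖ : ℂ) ≠ 0 := by simpa using hZ
  have hu : ‖(‖Z‖ : ℂ)⁻¹ • Z‖ = 1 := by simp [norm_smul, hZ]
  have h := hlift _ hu
  rwa [hΦ.equivariant t ht, toCP_smul (hΦ.map_ne_zero ht hZ) (inv_ne_zero hn),
    toCP_smul hZ (inv_ne_zero hn)] at h

lemma IsHamiltonianFlow.mdifferentiable {M : Type*} [TopologicalSpace M] [ChartedSpace (Cn d) M]
    {Ω : ∀ x : M, TangentSpace 𝓘(ℝ, Cn d) x → TangentSpace 𝓘(ℝ, Cn d) x → ℝ} {φ : ℝ → (M ≃ₜ M)}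
    (h : IsHamiltonianFlow Ω φ) {t : ℝ} (ht : t ∈ Icc (0 : ℝ) 1) :
    MDifferentiable 𝓘(ℝ, Cn d) 𝓘(ℝ, Cn d) (φ t) := by
  have h1 : ContMDiff 𝓘(ℝ, Cn d) 𝓘(ℝ, Cn d) ∞ ((fun p : ℝ × M => φ p.1 p.2) ∘ fun x => (t, x)) :=
    h.smooth.comp_contMDiff (contMDiff_const.prodMk contMDiff_id) fun x => ⟨ht, mem_univ _⟩
  exact h1.mdifferentiable (by simp)

/-- Two chain rules for the same germ. The lifting relation is needed on a neighbourhood of `Z`,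
hence off the sphere, where homogeneity provides it. -/
lemma mfderiv_quotDeriv (hΦ : IsEquivariantHamiltonianFlow Φ) (hφ : IsHamiltonianFlow fubiniStudy φ)
    {t : ℝ} (ht : t ∈ Icc (0 : ℝ) 1)
    (hlift : ∀ Z : Cn (d + 1), ‖Z‖ = 1 → toCP (Φ t Z) = φ t (toCP Z)) {Z : Cn (d + 1)}
    (hZ : Z ≠ 0) (v : Cn (d + 1)) :
    (mfderiv 𝓘(ℝ, Cn d) 𝓘(ℝ, Cn d) (φ t) (toCP Z) (quotDeriv Z v) : Cn d) =
      quotDeriv (Φ t Z) (fderiv ℝ (Φ t) Z v) := by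
  have h1 := (hφ.mdifferentiable ht (toCP Z)).hasMFDerivAt.comp Z (hasMFDerivAt_toCP hZ)
  have h2 := (hasMFDerivAt_toCP (hΦ.map_ne_zero ht hZ)).comp Z
    (hΦ.hasFDerivAt ht hZ).differentiableAt.hasFDerivAt.hasMFDerivAt
  have he : toCP ∘ Φ t =ᶠ[𝓝 Z] φ t ∘ toCP := by
    filter_upwards [isOpen_ne.mem_nhds hZ] with Y hY
    exact toCP_flow_of_lift hΦ ht hlift hY
  have h3 := hasMFDerivAt_unique (h1.congr_of_eventuallyEq he) h2
  exact congrArg (fun L : Cn (d + 1) →L[ℝ] Cn d => L v) h3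

/-- Horizontal lifts of `ξ` frame the complements of `U`. They conjugate `γ_t` to `dΦ_t(Z₀)` because
the image of a horizontal vector is horizontal (`inner_fderiv`), hence is recovered by lifting its
projection. -/
theorem hasMaslovIndex_trivializedPath (hΦ : IsEquivariantHamiltonianFlow Φ)
    (hφ : IsHamiltonianFlow fubiniStudy φ)
    (hlift : ∀ t ∈ Icc (0 : ℝ) 1, ∀ Z : Cn (d + 1), ‖Z‖ = 1 → toCP (Φ t Z) = φ t (toCP Z))
    {Z₀ : Cn (d + 1)} (hZ₀ : ‖Z₀‖ = 1) {U : ℂ → Cn (d + 1)}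
    (hU : IsCapping (fun t => Φ t Z₀) U) (hU1 : ∀ w ∈ Metric.closedBall (0 : ℂ) 1, ‖U w‖ = 1)
    {ξ : ∀ w : ℂ, Cn d ≃L[ℝ] TangentSpace 𝓘(ℝ, Cn d) ((toCP ∘ U) w)}
    (hξ : IsSymplecticTrivialization fubiniStudy (toCP ∘ U) ξ) {m : ℤ}
    (hm : HasMaslovIndex (fun t => fderiv ℝ (Φ t) Z₀) m) :
    HasMaslovIndex (trivializedPath φ (toCP Z₀) (toCP ∘ U) ξ) m := by
  have hZ0 : Z₀ ≠ 0 := ne_zero_of_norm_eq_one hZ₀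
  have hU1eq : U 1 = Z₀ := by
    rw [← circlePoint_zero, hU.boundary 0 (by simp)]
    exact hΦ.map_zero Z₀
  -- Each `TangentSpace` unfolds to `ℂᵈ`, so `ξ` can be handled as a family of automorphisms of one
  -- space.
  let x : ℂ → Cn d ≃L[ℝ] Cn d := ξ
  have hx1 (a : Cn d) : quotDeriv Z₀ (horizontalLift (U 1) (x 1 a)) = x 1 a := by
    rw [hU1eq, quotDeriv_horizontalLift hZ0]
  refine hasMaslovIndex_of_complement_frame hΦ hZ₀ hU hU1
    (ι := fun w => (horizontalLift (U w)).comp (x w).toLinearEquiv.toLinearMap)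
    (ρ := ((x 1).symm : Cn d →L[ℝ] Cn d) ∘L quotDeriv Z₀) ?_ (fun w hw a => ?_) (fun w hw a b => ?_)
    (fun a => ?_) (fun c => ?_) (fun v => ?_) (fun t ht a => ?_) hm
  · exact continuousOn_horizontalLift (hU.continuousOn.comp continuousOn_fst fun p hp => hp.1)
      (fun p hp => hU1 _ hp.1) hξ.continuousOn
  · exact inner_horizontalLift (hU1 w hw) _
  · exact (fubiniStudy_eq_stdForm_horizontalLift (hU1 w hw) _ _).symm.trans (hξ.symplectic w hw a b)
  · exact ((x 1).symm_apply_eq).2 (hx1 a)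
  · change (x 1).symm (quotDeriv Z₀ (c • Z₀)) = 0
    rw [quotDeriv_smul_self hZ0, map_zero]
  · change horizontalLift (U 1) (x 1 ((x 1).symm (quotDeriv Z₀ v))) + _ = _
    rw [ContinuousLinearEquiv.apply_symm_apply, hU1eq, horizontalLift_quotDeriv hZ₀]
    abel
  · have hUt : U (circlePoint t) = Φ t Z₀ := hU.boundary t ht
    have hn : ‖Φ t Z₀‖ = 1 := by
      rw [← hUt]
      exact hU1 _ (by rw [mem_closedBall_zero_iff, norm_circlePoint])
    have e : (mfderiv 𝓘(ℝ, Cn d) 𝓘(ℝ, Cn d) (φ t) (toCP Z₀) (x 1 a) : Cn d) =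
        quotDeriv (Φ t Z₀) (fderiv ℝ (Φ t) Z₀ (horizontalLift (U 1) (x 1 a))) := by
      rw [← mfderiv_quotDeriv hΦ hφ ht (hlift t ht) hZ0]
      exact congrArg (mfderiv 𝓘(ℝ, Cn d) 𝓘(ℝ, Cn d) (φ t) (toCP Z₀)) (hx1 a).symm
    have key (y : Cn d) (hy : y = quotDeriv (Φ t Z₀)
        (fderiv ℝ (Φ t) Z₀ (horizontalLift (U 1) (x 1 a)))) :
        horizontalLift (U (circlePoint t)) (x (circlePoint t) ((x (circlePoint t)).symm y)) =
          fderiv ℝ (Φ t) Z₀ (horizontalLift (U 1) (x 1 a)) := by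
      rw [ContinuousLinearEquiv.apply_symm_apply, hy, hUt, horizontalLift_quotDeriv hn,
        hΦ.inner_fderiv ht hZ0, hU1eq, inner_horizontalLift hZ₀, zero_smul, sub_zero]
    exact key _ e

end Comparison

end MaslovLift

end

/-! ### Equality of the two Maslov indices -/

open MaslovLift
theorem mainTheorem11 (d : ℕ)
    (Φ : ℝ → (Cn (d + 1) ≃ₜ Cn (d + 1))) (hΦ : IsEquivariantHamiltonianFlow Φ)
    (φ : ℝ → (CP d ≃ₜ CP d)) (hφ : IsHamiltonianFlow fubiniStudy φ)
    (hlift : ∀ t ∈ Icc (0 : ℝ) 1, ∀ Z : Cn (d + 1), ‖Z‖ = 1 → toCP (Φ t Z) = φ t (toCP Z))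
    (Z₀ : Cn (d + 1)) (hZ₀ : ‖Z₀‖ = 1) (hfix : Φ 1 Z₀ = Z₀)
    (U : ℂ → Cn (d + 1)) (hU : IsCapping (fun t => Φ t Z₀) U)
    (hUsphere : ∀ w ∈ Metric.closedBall (0 : ℂ) 1, ‖U w‖ = 1) :
    ∃ m : ℤ, HasMaslovIndex (fun t => fderiv ℝ (Φ t) Z₀) m ∧
      HasCappedMaslovIndex fubiniStudy φ (toCP Z₀) (toCP ∘ U) m := by
  have hZ0 : Z₀ ≠ 0 := ne_zero_of_norm_eq_one hZ₀
  obtain ⟨m, hm⟩ := exists_hasMaslovIndex (hΦ.continuousOn_fderiv hZ0)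
    (fun t ht => hΦ.isSymplecticMap_fderiv ht hZ0) (hΦ.fderiv_zero Z₀)
  refine ⟨m, hm, ⟨?_, fun t ht => ?_⟩, exists_isSymplecticTrivialization hU.continuousOn hUsphere,
    fun ξ hξ => hasMaslovIndex_trivializedPath hΦ hφ hlift hZ₀ hU hUsphere hξ hm⟩
  · exact fun w hw => (continuousAt_toCP (ne_zero_of_norm_eq_one (hUsphere w hw))
      ).comp_continuousWithinAt (hU.continuousOn w hw)
  · rw [Function.comp_apply, hU.boundary t ht, hlift t ht Z₀ hZ₀]
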